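/- **Setting.** Let $N\in\mathbb N$ and $\mathcal H=\ell^2(\mathbb Z^2)\otimes\mathbb C^N\otimes\mathbb C^2$. For an operator $A$ in $\mathcal H$ whose domain contains the canonical basis vectors $\delta_{\mathbf n}\otimes e_j\otimes\phi_s$, let $A_{\mathbf m,\mathbf n}\in\mathrm{End}(\mathbb C^N\otimes\mathbb C^2)$, $\mathbf m,\mathbf n\in\mathbb Z^2$, be its kernel. Let $H$ be a bounded self-adjoint operator on $\mathcal H$ such that * (near-sightedness) there are $C,\zeta>0$ with $|H_{\mathbf m,\mathbf n}|\le C\,e^{-\frac1\zeta\|\mathbf m-\mathbf n\|_1}$ for all $\mathbf m,\mathbf n\in\mathbb Z^2$; * (periodicity) $H_{\mathbf m,\mathbf n}=H_{\mathbf m-\mathbf p,\mathbf n-\mathbf p}$ for all $\mathbf m,\mathbf n,\mathbf p\in\mathbb Z^2$; * (gap) there are non-empty $I_1,I_2\subseteq\mathbb R$ and $a,b\in\mathbb R$ with $\mathrm{Spectrum}(H)=I_1\cup I_2$ and $\sup I_1<a<b<\inf I_2$. Let $\mu\in(a,b)$ and let $P=\chi_{(-\infty,\mu)}(H)$ be the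 Fermi projection. Let $(X_j\varphi)_{\mathbf n}=n_j\varphi_{\mathbf n}$ ($j=1,2$) be the position operators on their maximal domains and $S_z=\mathrm{Id}\otimes\mathrm{Id}\otimes\frac12 s_z$ with $s_z=\mathrm{diag}(1,-1)$. Sums, products and commutators of operators are taken on their natural domains. A *switch function in direction $j$* is a function $\Lambda:\mathbb Z^2\to[0,1]$ that depends only on $n_j$ and for which there are $n_-<n_+$ with $\Lambda=0$ if $n_j<n_-$ and $\Lambda=1$ if $n_j\ge n_+$; it is identified with the corresponding multiplication operator. For odd $L$ let $\chi_L$ and $\chi_{j,L}$ be (multiplication by) the characteristic functions of $\{\mathbf n:\|\mathbf n\|_\infty\le L/2\}$ and of $\{\mathbf n:|n_j|\le L/2\}$. Put $$\tau(A):=\lim_{L\to\infty,\ L\ \mathrm{odd}}\frac1{L^2}\mathrm{Tr}(\chi_LA\chi_L),\qquad 1\text{-}\mathrm{p.v.Tr}(A):=\lim_{L\to\infty,\ L\ \mathrm{odd}}\mathrm{Tr}(\chi_{1,L}A\chi_{1,L}),$$ which are said to be well-defined (finite) if the operators under the trace are trace class for every odd $L$ and the limit exists in $\mathbb C$. Finally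 set $$\Sigma_K^{s_z}:=iP\big[[P,X_1S_z],[P,X_2]\big]P,\qquad \mathcal T_{s_z}:=iP\big[[P,S_z],[P,X_2]\big]P,$$ $$G_K^{s_z}(\Lambda_1,\Lambda_2):=1\text{-}\mathrm{p.v.Tr}\Big(iP\big[[P,\Lambda_1S_z],[P,\Lambda_2]\big]P\Big)$$ for switch functions $\Lambda_1,\Lambda_2$ in directions $1$ and $2$. **Theorem.** 1. Let $\Lambda_2$ be a switch function in direction $2$. If $G_K^{s_z}(\Lambda_1,\Lambda_2)$ is finite for at least one switch function $\Lambda_1$ in direction $1$, then $G_K^{s_z}(\Lambda_1',\Lambda_2)$ is finite for every switch function $\Lambda_1'$ in direction $1$, and it does not depend on $\Lambda_1'$. 2. The domains of $\Sigma_K^{s_z}$ and $\mathcal T_{s_z}$ contain all the canonical basis vectors, and $$(\Sigma_K^{s_z})_{\mathbf m,\mathbf n}=(\Sigma_K^{s_z})_{\mathbf m-\mathbf p,\mathbf n-\mathbf p}+p_1\,(\mathcal T_{s_z})_{\mathbf m-\mathbf p,\mathbf n-\mathbf p}\qquad\text{for all }\mathbf m,\mathbf n,\mathbf p\in\mathbb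 Z^2.$$ Moreover $\sigma_K^{s_z}:=\tau(\Sigma_K^{s_z})$ is well-defined, and $\sigma_K^{s_z}=\mathrm{Tr}(\chi_1\Sigma_K^{s_z}\chi_1)$. 3. For all switch functions $\Lambda_1,\Lambda_2$ in directions $1$ and $2$, $G_K^{s_z}(\Lambda_1,\Lambda_2)$ is finite and $\sigma_K^{s_z}=G_K^{s_z}(\Lambda_1,\Lambda_2)$. In particular $G_K^{s_z}$ is independent of both switch functions. -/

import Mathlib

open scoped ComplexOrder

noncomputable section

namespace SpinTransport

/-! ### The Hilbert space `ℓ²(ℤ²) ⊗ ℂ^N ⊗ ℂ²` -/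

/-- The lattice `ℤ²`; the coordinate `n 0` is the first one, `n 1` the second one. -/
abbrev Lattice : Type := Fin 2 → ℤ

/-- Internal degrees of freedom: a point of the unit cell and a spin (`0` is up, `1` is down). -/
abbrev Internal (N : ℕ) : Type := Fin N × Fin 2

/-- Labels of the canonical orthonormal basis `δ_n ⊗ e_j ⊗ φ_s`. -/
abbrev Site (N : ℕ) : Type := Lattice × Internal N

/-- `ℓ²(ℤ²) ⊗ ℂ^N ⊗ ℂ²`, realised as the space of square-summable families on
`ℤ² × {1, …, N} × {↑, ↓}`. -/
abbrev Hdisc (N : ℕ) : Type := lp (fun _ : Site N => ℂ) 2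

/-- The canonical orthonormal basis vector `δ_n ⊗ e_j ⊗ φ_s`. -/
def delta {N : ℕ} (x : Site N) : Hdisc N := lp.single 2 x (1 : ℂ)

/-! ### Operators: linear maps defined on a subspace, with the natural domains -/

/-- An everywhere defined bounded operator. -/
def ofBounded {N : ℕ} (A : Hdisc N →L[ℂ] Hdisc N) : Hdisc N →ₗ.[ℂ] Hdisc N :=
  (A : Hdisc N →ₗ[ℂ] Hdisc N).toPMap ⊤

/-- The product `B A` on its natural domain `{φ ∈ D(A) | A φ ∈ D(B)}`. -/
def prod {N : ℕ} (B A : Hdisc N →ₗ.[ℂ] Hdisc N) : Hdisc N →ₗ.[ℂ] Hdisc N where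
  domain := (B.domain.comap A.toFun).map A.domain.subtype
  toFun :=
    { toFun := fun φ => B ⟨A ⟨φ.1, by
          obtain ⟨y, -, hy⟩ := φ.2
          exact hy ▸ y.2⟩, by
          obtain ⟨φ, y, h, rfl⟩ := φ
          exact h⟩
      map_add' := fun φ ψ => by
        rw [← LinearPMap.map_add]
        congr 1
        apply Subtype.ext
        exact LinearPMap.map_add A ⟨φ.1, _⟩ ⟨ψ.1, _⟩
      map_smul' := fun c φ => by
        rw [RingHom.id_apply, ← LinearPMap.map_smul]
        congr 1
        apply Subtype.ext
        exact LinearPMap.map_smul A c ⟨φ.1, _⟩ }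

/-- The commutator `[A, B] = A B - B A` on its natural domain `D(A B) ∩ D(B A)`. -/
def comm {N : ℕ} (A B : Hdisc N →ₗ.[ℂ] Hdisc N) : Hdisc N →ₗ.[ℂ] Hdisc N :=
  prod A B - prod B A

/-- Multiplication by a function of the site, on its maximal domain
`{φ | f φ is square-summable}`. -/
def mulOp {N : ℕ} (f : Site N → ℝ) : Hdisc N →ₗ.[ℂ] Hdisc N where
  domain :=
    { carrier := {φ | Memℓp (fun x => (f x : ℂ) * φ x) 2}
      add_mem' := fun {φ ψ} hφ hψ => by
        have h := Memℓp.add hφ hψ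
        refine (congrArg (fun g => Memℓp g 2) (funext fun x => ?_)).mp h
        exact (mul_add _ _ _).symm
      zero_mem' := by
        refine (congrArg (fun g => Memℓp g 2) (funext fun x => ?_)).mp
          (zero_memℓp (E := fun _ : Site N => ℂ))
        simp
      smul_mem' := fun c φ hφ => by
        have h := Memℓp.const_smul hφ c
        refine (congrArg (fun g => Memℓp g 2) (funext fun x => ?_)).mp h
        simp [mul_left_comm] }
  toFun :=
    { toFun := fun φ => ⟨fun x => (f x : ℂ) * φ.1 x, φ.2⟩
      map_add' := fun φ ψ => by
        apply Subtype.ext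
        funext x
        exact mul_add _ _ _
      map_smul' := fun c φ => by
        apply Subtype.ext
        funext x
        simp [mul_left_comm] }

/-- Multiplication by a function of the lattice point, acting as the identity on `ℂ^N ⊗ ℂ²`. -/
def latOp (N : ℕ) (f : Lattice → ℝ) : Hdisc N →ₗ.[ℂ] Hdisc N := mulOp fun x => f x.1

/-- The position operator `X_j`. -/
def X (N : ℕ) (j : Fin 2) : Hdisc N →ₗ.[ℂ] Hdisc N := latOp N fun n => (n j : ℝ)

/-- The spin operator `S_z = 1 ⊗ 1 ⊗ s_z / 2`, where `s_z = diag (1, -1)`. -/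
def Sz (N : ℕ) : Hdisc N →ₗ.[ℂ] Hdisc N := mulOp fun x => if x.2.2 = 0 then 1 / 2 else -(1 / 2)

/-! ### Kernels, near-sightedness, periodicity, spectral gap -/

open Classical in
/-- The matrix `A_{m,n}` with entries `⟨δ_m ⊗ e_j ⊗ φ_s, A (δ_n ⊗ e_k ⊗ φ_r)⟩`; meaningful when
the basis vectors belong to the domain of `A`. -/
def kernel {N : ℕ} (A : Hdisc N →ₗ.[ℂ] Hdisc N) (m n : Lattice) :
    Matrix (Internal N) (Internal N) ℂ :=
  Matrix.of fun i k =>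
    if h : delta (n, k) ∈ A.domain then inner ℂ (delta (m, i)) (A ⟨delta (n, k), h⟩) else 0

/-- `|A_{m,n}| ≤ C exp (-‖m - n‖₁ / ζ)`, with the operator norm of the matrix `A_{m,n}`. -/
def IsNearSighted {N : ℕ} (A : Hdisc N →L[ℂ] Hdisc N) : Prop :=
  ∃ C ζ : ℝ, 0 < C ∧ 0 < ζ ∧ ∀ m n : Lattice,
    ‖Matrix.toEuclideanCLM (𝕜 := ℂ) (kernel (ofBounded A) m n)‖ ≤
      C * Real.exp (-(1 / ζ) * ∑ j, |((m j : ℝ) - n j)|)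

/-- `A_{m,n} = A_{m-p,n-p}`. -/
def IsPeriodic {N : ℕ} (A : Hdisc N →L[ℂ] Hdisc N) : Prop :=
  ∀ m n p : Lattice, kernel (ofBounded A) m n = kernel (ofBounded A) (m - p) (n - p)

/-- The interval `(a, b)` is a spectral gap of `A`: its spectrum is a union of two non-empty sets
of reals, one below `a`, the other above `b`. -/
def HasSpectralGap {N : ℕ} (A : Hdisc N →L[ℂ] Hdisc N) (a b : ℝ) : Prop :=
  ∃ I₁ I₂ : Set ℝ, I₁.Nonempty ∧ I₂.Nonempty ∧
    spectrum ℂ A = (fun r : ℝ => (r : ℂ)) '' (I₁ ∪ I₂) ∧ sSup I₁ < a ∧ a < b ∧ b < sInf I₂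

/-- The spectral projection `χ_{(-∞, μ)}(H)` of a bounded self-adjoint operator `H` on a Hilbert
space, for `μ` outside the spectrum of `H`: the characteristic function is then continuous on the
spectrum, so that the continuous functional calculus applies. -/
def spectralProjBelow {E : Type*} [NormedAddCommGroup E] [InnerProductSpace ℂ E] [CompleteSpace E]
    (H : E →L[ℂ] E) (μ : ℝ) : E →L[ℂ] E :=
  cfc ((Set.Iio μ).indicator fun _ => (1 : ℝ)) H

/-- The absolute value `|A| = (A* A)^{1/2}` of a bounded operator on a Hilbert space. -/
def absOp {E : Type*} [NormedAddCommGroup E] [InnerProductSpace ℂ E] [CompleteSpace E]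
    (A : E →L[ℂ] E) : E →L[ℂ] E :=
  CFC.abs A

/-- The Fermi projection `χ_{(-∞, μ)}(H)`, for `μ` in a spectral gap. -/
def fermi {N : ℕ} (H : Hdisc N →L[ℂ] Hdisc N) (μ : ℝ) : Hdisc N →L[ℂ] Hdisc N :=
  spectralProjBelow H μ

/-! ### Trace, directional principal value trace, trace per unit volume -/

/-- A bounded operator is trace class if `Tr |A| < ∞` (the trace of the positive operator
`|A|` may be computed in any orthonormal basis). -/
def IsTraceClass {N : ℕ} (A : Hdisc N →L[ℂ] Hdisc N) : Prop :=
  Summable fun x : Site N => (inner ℂ (delta x) (absOp A (delta x))).re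

/-- `A` is an everywhere defined bounded operator, it is trace class and its trace is `t`. -/
def HasTrace {N : ℕ} (A : Hdisc N →ₗ.[ℂ] Hdisc N) (t : ℂ) : Prop :=
  ∃ B : Hdisc N →L[ℂ] Hdisc N, A = ofBounded B ∧ IsTraceClass B ∧
    HasSum (fun x : Site N => inner ℂ (delta x) (B (delta x))) t

/-- The characteristic function `χ_L` of the square `{n | ‖n‖_∞ ≤ L / 2}`. -/
def chi (N L : ℕ) : Hdisc N →ₗ.[ℂ] Hdisc N :=
  latOp N ({n : Lattice | ∀ j, |(n j : ℝ)| ≤ (L : ℝ) / 2}.indicator fun _ => 1)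

/-- The characteristic function `χ_{j,L}` of the stripe `{n | |n_j| ≤ L / 2}`. -/
def chiDir (N : ℕ) (j : Fin 2) (L : ℕ) : Hdisc N →ₗ.[ℂ] Hdisc N :=
  latOp N ({n : Lattice | |(n j : ℝ)| ≤ (L : ℝ) / 2}.indicator fun _ => 1)

/-- The `j`-directional principal value trace of `A` exists (as a finite limit over odd `L`) and
is equal to `g`. -/
def HasDirPVTrace {N : ℕ} (j : Fin 2) (A : Hdisc N →ₗ.[ℂ] Hdisc N) (g : ℂ) : Prop :=
  ∃ t : ℕ → ℂ,
    (∀ k, HasTrace (prod (chiDir N j (2 * k + 1)) (prod A (chiDir N j (2 * k + 1)))) (t k)) ∧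
    Filter.Tendsto t Filter.atTop (nhds g)

/-- The trace per unit volume of `A` exists (as a finite limit over odd `L`) and is equal
to `s`. -/
def HasTUV {N : ℕ} (A : Hdisc N →ₗ.[ℂ] Hdisc N) (s : ℂ) : Prop :=
  ∃ t : ℕ → ℂ,
    (∀ k, HasTrace (prod (chi N (2 * k + 1)) (prod A (chi N (2 * k + 1)))) (t k)) ∧
    Filter.Tendsto (fun k : ℕ => 1 / ((2 * k + 1 : ℕ) : ℂ) ^ 2 * t k) Filter.atTop (nhds s)

/-! ### Switch functions and the Kubo-like operators -/

/-- A switch function in direction `j`. -/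
def IsSwitch (j : Fin 2) (Λ : Lattice → ℝ) : Prop :=
  (∀ n, Λ n ∈ Set.Icc (0 : ℝ) 1) ∧ (∀ m n : Lattice, m j = n j → Λ m = Λ n) ∧
    ∃ a b : ℤ, a < b ∧ (∀ n : Lattice, n j < a → Λ n = 0) ∧ ∀ n : Lattice, b ≤ n j → Λ n = 1

/-- `i P [[P, A], [P, B]] P` on its natural domain. -/
def kubo {N : ℕ} (P : Hdisc N →L[ℂ] Hdisc N) (A B : Hdisc N →ₗ.[ℂ] Hdisc N) :
    Hdisc N →ₗ.[ℂ] Hdisc N :=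
  Complex.I • prod (ofBounded P)
    (prod (comm (comm (ofBounded P) A) (comm (ofBounded P) B)) (ofBounded P))

/-- `i P [[P, Λ₁ S_z], [P, Λ₂]] P`, whose 1-directional principal value trace is the Kubo-like
spin conductance. -/
def conductanceOp {N : ℕ} (P : Hdisc N →L[ℂ] Hdisc N) (Λ₁ Λ₂ : Lattice → ℝ) :
    Hdisc N →ₗ.[ℂ] Hdisc N :=
  kubo P (prod (latOp N Λ₁) (Sz N)) (latOp N Λ₂)

/-- `Σ = i P [[P, X₁ S_z], [P, X₂]] P`, whose trace per unit volume is the Kubo-like spin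
conductivity. -/
def conductivityOp {N : ℕ} (P : Hdisc N →L[ℂ] Hdisc N) : Hdisc N →ₗ.[ℂ] Hdisc N :=
  kubo P (prod (X N 0) (Sz N)) (X N 1)

/-- The spin torque-response `𝒯 = i P [[P, S_z], [P, X₂]] P`. -/
def torqueOp {N : ℕ} (P : Hdisc N →L[ℂ] Hdisc N) : Hdisc N →ₗ.[ℂ] Hdisc N :=
  kubo P (Sz N) (X N 1)

end SpinTransport

end

/-!
Polynomials in `H` inherit its near-sightedness, and on the gapped spectrum they approximate the
Fermi projection exponentially well in the degree; hence the kernel of `P` decays fast. The entries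
of `i P [[P, A], [P, B]] P`, for multiplication operators `A` and `B`, are then absolutely
convergent sums, over paths of three steps, of products of entries of `P` antisymmetrised in `A` and
`B`, and they do not change when a constant is added to `B`.

Cyclicity of the trace per unit cell makes the trace of the torque-response over a cell vanish.
Therefore the trace of `Σ` over a cell is the same for all cells, which gives `σ`, and additive
constants in `Λ₁` are invisible in the trace over a line of cells. Finally, the sum over all
translates of `l (x + n) - l n`, for a step `l`, is `x`: summing the diagonal of the conductance
operator over the direction 2 replaces `Λ₂` by `X₂`, and summing it over the direction 1 replaces
`Λ₁` by `X₁`.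
-/

noncomputable section

namespace SpinTransport

open scoped ENNReal

variable {N : ℕ}

theorem inner_delta (x : Site N) (φ : Hdisc N) : inner ℂ (delta x) φ = φ x := by
  classical
  simpa [delta] using lp.inner_single_left (𝕜 := ℂ) x (1 : ℂ) φ

theorem delta_apply (x y : Site N) : (delta x : Hdisc N) y = if y = x then 1 else 0 := by
  classical
  rw [delta, lp.single_apply, Pi.single_apply]

theorem norm_delta (x : Site N) : ‖(delta x : Hdisc N)‖ = 1 := by
  classical
  rw [delta, lp.norm_single (by norm_num), norm_one]

theorem hasSum_delta (φ : Hdisc N) : HasSum (fun x => φ x • (delta x : Hdisc N)) φ := by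
  classical
  refine (lp.hasSum_single (E := fun _ : Site N => ℂ) (p := 2) (by norm_num) φ).congr_fun
    fun x => ?_
  rw [delta, ← lp.single_smul, smul_eq_mul, mul_one]

theorem enorm_le_tsum_enorm (φ : Hdisc N) : ‖φ‖ₑ ≤ ∑' x, ‖φ x‖ₑ :=
  calc ‖φ‖ₑ = ‖∑' x, φ x • (delta x : Hdisc N)‖ₑ := by rw [(hasSum_delta φ).tsum_eq]
    _ ≤ ∑' x, ‖φ x • (delta x : Hdisc N)‖ₑ := enorm_tsum_le_tsum_enorm
    _ = ∑' x, ‖φ x‖ₑ := by simp only [enorm_smul, ← ofReal_norm (delta _), norm_delta,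
        ENNReal.ofReal_one, mul_one]

/-- The matrix entry `⟨δ_x, A δ_y⟩`. -/
def entry (A : Hdisc N →L[ℂ] Hdisc N) (x y : Site N) : ℂ := A (delta y) x

theorem entry_eq_inner (A : Hdisc N →L[ℂ] Hdisc N) (x y : Site N) :
    entry A x y = inner ℂ (delta x) (A (delta y)) := (inner_delta x _).symm

theorem hasSum_entry_mul (A : Hdisc N →L[ℂ] Hdisc N) (φ : Hdisc N) (x : Site N) :
    HasSum (fun y => entry A x y * φ y) (A φ x) := by
  have h := (hasSum_delta φ).mapL ((innerSL ℂ (delta x)).comp A)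
  simp only [ContinuousLinearMap.comp_apply, innerSL_apply_apply, inner_delta, map_smul,
    smul_eq_mul] at h
  exact h.congr_fun fun y => mul_comm _ _

theorem apply_eq_tsum (A : Hdisc N →L[ℂ] Hdisc N) (φ : Hdisc N) (x : Site N) :
    A φ x = ∑' y, entry A x y * φ y := (hasSum_entry_mul A φ x).tsum_eq.symm

theorem entry_mul (A B : Hdisc N →L[ℂ] Hdisc N) (x y : Site N) :
    entry (A * B) x y = ∑' u, entry A x u * entry B u y :=
  apply_eq_tsum A _ x

theorem norm_entry_le_norm_apply (A : Hdisc N →L[ℂ] Hdisc N) (x y : Site N) :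
    ‖entry A x y‖ ≤ ‖A (delta y)‖ :=
  lp.norm_apply_le_norm two_ne_zero _ x

theorem norm_entry_le (A : Hdisc N →L[ℂ] Hdisc N) (x y : Site N) : ‖entry A x y‖ ≤ ‖A‖ :=
  (norm_entry_le_norm_apply A x y).trans (by simpa [norm_delta] using A.le_opNorm (delta y))

/-! ### Graphs of operators -/

theorem mem_graph_sub {R E F : Type*} [Ring R] [AddCommGroup E] [Module R E] [AddCommGroup F]
    [Module R F] {A B : E →ₗ.[R] F} {φ : E} {ψ χ : F} (h : (φ, ψ) ∈ A.graph)
    (h' : (φ, χ) ∈ B.graph) : (φ, ψ - χ) ∈ (A - B).graph := by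
  rw [LinearPMap.mem_graph_iff] at h h' ⊢
  obtain ⟨y, rfl, rfl⟩ := h
  obtain ⟨z, hz, rfl⟩ := h'
  have hy : (y : E) ∈ B.domain := by
    rw [← show (z : E) = y from hz]; exact z.2
  exact ⟨⟨y, y.2, hy⟩, rfl, congrArg (A y - B ·) (Subtype.ext hz.symm)⟩

theorem mem_graph_prod {A B : Hdisc N →ₗ.[ℂ] Hdisc N} {φ ψ χ : Hdisc N} (h : (φ, ψ) ∈ A.graph)
    (h' : (ψ, χ) ∈ B.graph) : (φ, χ) ∈ (prod B A).graph := by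
  rw [LinearPMap.mem_graph_iff] at h h' ⊢
  obtain ⟨y, rfl, rfl⟩ := h
  obtain ⟨z, hz, rfl⟩ := h'
  have hAy : A y ∈ B.domain := by
    rw [← show (z : Hdisc N) = A y from hz]; exact z.2
  exact ⟨⟨y, y, hAy, rfl⟩, rfl, congrArg B (Subtype.ext hz.symm)⟩

theorem mem_graph_prod_iff {A B : Hdisc N →ₗ.[ℂ] Hdisc N} {φ χ : Hdisc N} :
    (φ, χ) ∈ (prod B A).graph ↔ ∃ ψ, (φ, ψ) ∈ A.graph ∧ (ψ, χ) ∈ B.graph := by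
  refine ⟨fun h => ?_, fun ⟨ψ, hφ, hψ⟩ => mem_graph_prod hφ hψ⟩
  obtain ⟨⟨_, y, hy, rfl⟩, rfl, rfl⟩ := (LinearPMap.mem_graph_iff _).1 h
  exact ⟨A y, A.mem_graph y, B.mem_graph ⟨A y, hy⟩⟩

theorem mem_graph_comm {A B : Hdisc N →ₗ.[ℂ] Hdisc N} {φ ψ χ ψ' χ' : Hdisc N}
    (hB : (φ, ψ) ∈ B.graph) (hAB : (ψ, χ) ∈ A.graph) (hA : (φ, ψ') ∈ A.graph)
    (hBA : (ψ', χ') ∈ B.graph) : (φ, χ - χ') ∈ (comm A B).graph :=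
  mem_graph_sub (mem_graph_prod hB hAB) (mem_graph_prod hA hBA)

theorem mem_graph_ofBounded (A : Hdisc N →L[ℂ] Hdisc N) (φ : Hdisc N) :
    (φ, A φ) ∈ (ofBounded A).graph :=
  (LinearPMap.mem_graph_iff _).2 ⟨⟨φ, trivial⟩, rfl, rfl⟩

theorem mem_graph_mulOp {f : Site N → ℝ} {φ ψ : Hdisc N} :
    (φ, ψ) ∈ (mulOp f).graph ↔ ∀ x, ψ x = f x * φ x := by
  rw [LinearPMap.mem_graph_iff]
  constructor
  · rintro ⟨y, rfl, rfl⟩ x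
    rfl
  · intro h
    have hψ : (fun x => (f x : ℂ) * φ x) = ψ := funext fun x => (h x).symm
    have hφ : φ ∈ (mulOp f).domain := by
      change Memℓp (fun x => (f x : ℂ) * φ x) 2
      rw [hψ]; exact lp.memℓp ψ
    exact ⟨⟨φ, hφ⟩, rfl, Subtype.ext hψ⟩

theorem eq_ofBounded {A : Hdisc N →ₗ.[ℂ] Hdisc N} {B : Hdisc N →L[ℂ] Hdisc N}
    (h : ∀ φ, (φ, B φ) ∈ A.graph) : A = ofBounded B := by
  refine (LinearPMap.eq_of_le_of_domain_eq (f := ofBounded B) (LinearPMap.le_of_le_graph ?_)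
    (le_antisymm (fun φ _ => LinearPMap.mem_domain_of_mem_graph (h φ)) fun φ _ => trivial)).symm
  rintro ⟨φ, ψ⟩ hφ
  obtain ⟨y, rfl, rfl⟩ := (LinearPMap.mem_graph_iff _).1 hφ
  exact h y

theorem kernel_apply_of_mem_graph {A : Hdisc N →ₗ.[ℂ] Hdisc N} {m n : Lattice}
    {i k : Internal N} {ψ : Hdisc N} (h : (delta (n, k), ψ) ∈ A.graph) :
    kernel A m n i k = ψ (m, i) := by
  have hdom : delta (n, k) ∈ A.domain := LinearPMap.mem_domain_of_mem_graph h
  rw [kernel, Matrix.of_apply, dif_pos hdom, inner_delta,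
    LinearPMap.mem_graph_snd_inj _ (LinearPMap.mem_graph A ⟨_, hdom⟩) h rfl]

theorem kernel_ofBounded (A : Hdisc N →L[ℂ] Hdisc N) (m n : Lattice) (i k : Internal N) :
    kernel (ofBounded A) m n i k = entry A (m, i) (n, k) :=
  kernel_apply_of_mem_graph (mem_graph_ofBounded A _)

theorem mem_graph_comm_ofBounded {P : Hdisc N →L[ℂ] Hdisc N} (hP : IsIdempotentElem P)
    {A B : Hdisc N →ₗ.[ℂ] Hdisc N} {φ b ab apb : Hdisc N} (hb : (P φ, b) ∈ B.graph)
    (hapb : (P b, apb) ∈ A.graph) (hab : (b, ab) ∈ A.graph) :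
    (P φ, P (apb - ab)) ∈ (prod (comm (ofBounded P) A) (comm (ofBounded P) B)).graph := by
  have hPP : ∀ ψ, P (P ψ) = P ψ := fun ψ => DFunLike.congr_fun hP.eq ψ
  have hcommB : (P φ, P b - b) ∈ (comm (ofBounded P) B).graph :=
    mem_graph_comm hb (mem_graph_ofBounded P b) (mem_graph_ofBounded P _) (by rwa [hPP])
  have hcommA : (P b - b, P (apb - ab) - 0) ∈ (comm (ofBounded P) A).graph := by
    refine mem_graph_comm (A.graph.sub_mem hapb hab) (mem_graph_ofBounded P _)
      (mem_graph_ofBounded P _) ?_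
    rw [map_sub, hPP, sub_self]
    exact A.graph.zero_mem
  exact mem_graph_prod hcommB (by rwa [sub_zero] at hcommA)

/-- When `A` and `B` commute on the range of `P`, the double commutator reduces to
`P A P B P - P B P A P`, since `[P, A] [P, B] P = P A P B P - P A B P`. -/
theorem mem_graph_kubo {P : Hdisc N →L[ℂ] Hdisc N} (hP : IsIdempotentElem P)
    {A B : Hdisc N →ₗ.[ℂ] Hdisc N} {φ a b ab apb bpa : Hdisc N} (ha : (P φ, a) ∈ A.graph)
    (hb : (P φ, b) ∈ B.graph) (hapb : (P b, apb) ∈ A.graph) (hbpa : (P a, bpa) ∈ B.graph)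
    (hab : (b, ab) ∈ A.graph) (hba : (a, ab) ∈ B.graph) :
    (φ, Complex.I • (P apb - P bpa)) ∈ (kubo P A B).graph := by
  have hPP : ∀ ψ, P (P ψ) = P ψ := fun ψ => DFunLike.congr_fun hP.eq ψ
  have hcomm := mem_graph_sub (mem_graph_comm_ofBounded hP hb hapb hab)
    (mem_graph_comm_ofBounded hP ha hbpa hba)
  have h := mem_graph_prod (mem_graph_prod (mem_graph_ofBounded P φ) hcomm)
    (mem_graph_ofBounded P _)
  rw [show P (P (apb - ab) - P (bpa - ab)) = P apb - P bpa by
    simp only [map_sub, hPP]; abel] at h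
  obtain ⟨y, rfl, hy⟩ := (LinearPMap.mem_graph_iff _).1 h
  exact (LinearPMap.mem_graph_iff _).2 ⟨y, rfl, congrArg (Complex.I • ·) hy⟩

/-! ### Multiplication by bounded functions -/

section BoundedMul

variable {f : Site N → ℝ} {C : ℝ}

theorem norm_mul_apply_le_norm_smul_apply (hf : ∀ x, |f x| ≤ C) (φ : Hdisc N) (x : Site N) :
    ‖(f x : ℂ) * φ x‖ ≤ ‖((C : ℂ) • φ) x‖ := by
  rw [norm_mul, Complex.norm_real, lp.coeFn_smul, Pi.smul_apply, norm_smul, Complex.norm_real]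
  exact mul_le_mul_of_nonneg_right ((hf x).trans (le_abs_self C)) (norm_nonneg _)

variable (f) (hf : ∀ x, |f x| ≤ C)

/-- Multiplication by a bounded function, as a bounded operator. -/
def boundedMul : Hdisc N →L[ℂ] Hdisc N :=
  LinearMap.mkContinuous
    { toFun := fun φ => ⟨fun x => (f x : ℂ) * φ x,
        (lp.memℓp ((C : ℂ) • φ)).mono' (norm_mul_apply_le_norm_smul_apply hf φ)⟩
      map_add' := fun φ ψ => Subtype.ext (funext fun x => mul_add _ _ _)
      map_smul' := fun c φ => Subtype.ext (funext fun x => by simp [mul_left_comm]) } ‖(C : ℂ)‖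
    fun φ => (lp.norm_mono two_ne_zero (norm_mul_apply_le_norm_smul_apply hf φ)).trans_eq
      (norm_smul _ _)

variable {f}

theorem boundedMul_apply (φ : Hdisc N) (x : Site N) : boundedMul f hf φ x = f x * φ x := rfl

theorem mem_graph_boundedMul (φ : Hdisc N) : (φ, boundedMul f hf φ) ∈ (mulOp f).graph :=
  mem_graph_mulOp.2 fun _ => rfl

theorem norm_boundedMul_apply_le (φ : Hdisc N) : ‖boundedMul f hf φ‖ ≤ |C| * ‖φ‖ := by
  refine (lp.norm_mono two_ne_zero (norm_mul_apply_le_norm_smul_apply hf φ)).trans_eq ?_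
  rw [norm_smul, Complex.norm_real, Real.norm_eq_abs]

theorem boundedMul_delta (y : Site N) :
    boundedMul f hf (delta y) = (f y : ℂ) • (delta y : Hdisc N) := by
  ext x
  rw [boundedMul_apply, lp.coeFn_smul, Pi.smul_apply, smul_eq_mul, delta_apply]
  split_ifs with h
  · rw [h]
  · simp only [mul_zero]

end BoundedMul

theorem prod_mulOp_mulOp (f : Site N → ℝ) {g : Site N → ℝ} {C : ℝ} (hg : ∀ x, |g x| ≤ C) :
    prod (mulOp f) (mulOp g) = mulOp fun x => f x * g x := by
  refine LinearPMap.eq_of_eq_graph (Submodule.ext fun ⟨φ, χ⟩ => ?_)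
  simp only [mem_graph_prod_iff, mem_graph_mulOp, Complex.ofReal_mul, mul_assoc]
  refine ⟨fun ⟨ψ, hψ, hχ⟩ x => by rw [hχ, hψ], fun h => ⟨boundedMul g hg φ, fun _ => rfl, h⟩⟩

/-- The orthogonal projection onto the sequences supported on `S`. -/
def cutoff (S : Set (Site N)) : Hdisc N →L[ℂ] Hdisc N :=
  boundedMul (S.indicator 1) (C := 1) fun x => by
    by_cases hx : x ∈ S <;> simp [hx]

theorem mem_graph_cutoff (S : Set (Site N)) (φ : Hdisc N) :
    (φ, cutoff S φ) ∈ (mulOp (S.indicator 1)).graph :=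
  mem_graph_boundedMul _ φ

theorem cutoff_apply (S : Set (Site N)) (φ : Hdisc N) (x : Site N) :
    cutoff S φ x = S.indicator φ x := by
  rw [cutoff, boundedMul_apply]
  by_cases hx : x ∈ S <;> simp [hx]

theorem cutoff_delta_of_mem {S : Set (Site N)} {y : Site N} (hy : y ∈ S) :
    cutoff S (delta y) = delta y := by
  simp [cutoff, boundedMul_delta, hy]

theorem cutoff_delta_of_notMem {S : Set (Site N)} {y : Site N} (hy : y ∉ S) :
    cutoff S (delta y) = 0 := by
  simp [cutoff, boundedMul_delta, hy]

theorem norm_cutoff_apply_le (S : Set (Site N)) (φ : Hdisc N) : ‖cutoff S φ‖ ≤ ‖φ‖ := by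
  simpa [cutoff] using norm_boundedMul_apply_le (C := 1) _ φ

theorem cutoff_finset_eq_sum (F : Finset (Site N)) (φ : Hdisc N) :
    cutoff (F : Set (Site N)) φ = ∑ y ∈ F, φ y • (delta y : Hdisc N) := by
  classical
  ext x
  rw [cutoff_apply, lp.coeFn_sum]
  simp [Set.indicator_apply, delta_apply]

/-! ### Traces of compressions -/

theorem norm_absOp_apply {E : Type*} [NormedAddCommGroup E] [InnerProductSpace ℂ E]
    [CompleteSpace E] (A : E →L[ℂ] E) (φ : E) : ‖absOp A φ‖ = ‖A φ‖ := by
  have hsa : star (absOp A) = absOp A := (CFC.abs_nonneg A).isSelfAdjoint.star_eq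
  have hsq : star (absOp A) * absOp A = star A * A := by
    rw [hsa]; exact CFC.abs_mul_abs A
  have hinner : inner ℂ (absOp A φ) (absOp A φ) = (inner ℂ (A φ) (A φ) : ℂ) := by
    simp only [← ContinuousLinearMap.adjoint_inner_right, ← ContinuousLinearMap.star_eq_adjoint]
    exact congrArg (inner ℂ φ) (DFunLike.congr_fun hsq φ)
  rw [inner_self_eq_norm_sq_to_K, inner_self_eq_norm_sq_to_K] at hinner
  exact (sq_eq_sq₀ (norm_nonneg _) (norm_nonneg _)).1 (by exact_mod_cast hinner)

theorem isTraceClass_of_summable {A : Hdisc N →L[ℂ] Hdisc N}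
    (h : Summable fun x : Site N => ‖A (delta x)‖) : IsTraceClass A := by
  refine Summable.of_norm_bounded h fun x => ?_
  calc ‖(inner ℂ (delta x) (absOp A (delta x))).re‖
      ≤ ‖inner ℂ (delta x) (absOp A (delta x))‖ := Complex.abs_re_le_norm _
    _ ≤ ‖(delta x : Hdisc N)‖ * ‖absOp A (delta x)‖ := norm_inner_le_norm _ _
    _ = ‖A (delta x)‖ := by rw [norm_delta, one_mul, norm_absOp_apply]

theorem hasTrace_of_summable {A : Hdisc N →ₗ.[ℂ] Hdisc N} {B : Hdisc N →L[ℂ] Hdisc N}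
    (hAB : ∀ φ, (φ, B φ) ∈ A.graph) (h : Summable fun x : Site N => ‖B (delta x)‖) :
    HasTrace A (∑' x, entry B x x) := by
  refine ⟨B, eq_ofBounded hAB, isTraceClass_of_summable h, ?_⟩
  simp only [← entry_eq_inner]
  exact (Summable.of_norm_bounded h fun x => norm_entry_le_norm_apply B x x).hasSum

theorem hasTrace_compression {A : Hdisc N →ₗ.[ℂ] Hdisc N} {B : Hdisc N →L[ℂ] Hdisc N}
    {S : Set (Site N)} (hAB : ∀ φ, (cutoff S φ, B φ) ∈ A.graph)
    (h : Summable fun x : Site N => ‖B (delta x)‖) :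
    HasTrace (prod (mulOp (S.indicator 1)) (prod A (mulOp (S.indicator 1))))
      (∑' x, S.indicator (fun x => entry B x x) x) := by
  have ht := hasTrace_of_summable (B := cutoff S * B)
    (fun φ => mem_graph_prod (mem_graph_prod (mem_graph_cutoff S φ) (hAB φ))
      (mem_graph_cutoff S _))
    (Summable.of_nonneg_of_le (fun _ => norm_nonneg _) (fun x => norm_cutoff_apply_le S _) h)
  convert ht using 3 with x
  exact (cutoff_apply S _ x).symm

theorem hasTrace_compression_of_bounded {A : Hdisc N →ₗ.[ℂ] Hdisc N}
    {G : Hdisc N →L[ℂ] Hdisc N} (hG : ∀ φ, (φ, G φ) ∈ A.graph) {S : Set (Site N)}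
    (h : Summable (S.indicator fun x => ‖G (delta x)‖)) :
    HasTrace (prod (mulOp (S.indicator 1)) (prod A (mulOp (S.indicator 1))))
      (∑' x, S.indicator (fun x => entry G x x) x) := by
  have ht := hasTrace_compression (B := G * cutoff S) (fun φ => hG (cutoff S φ)) <|
    h.congr fun x => by
      by_cases hx : x ∈ S <;> simp [hx, cutoff_delta_of_mem, cutoff_delta_of_notMem]
  convert ht using 3 with x
  by_cases hx : x ∈ S <;> simp [hx, entry, cutoff_delta_of_mem]

theorem hasTrace_compression_of_finite {A : Hdisc N →ₗ.[ℂ] Hdisc N} (F : Finset (Site N))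
    {V : Site N → Hdisc N} (hV : ∀ y ∈ F, (delta y, V y) ∈ A.graph) :
    HasTrace (prod (mulOp ((F : Set (Site N)).indicator 1))
      (prod A (mulOp ((F : Set (Site N)).indicator 1)))) (∑ y ∈ F, V y y) := by
  classical
  set B : Hdisc N →L[ℂ] Hdisc N := ∑ y ∈ F, (innerSL ℂ (delta y)).smulRight (V y)
  have hB : ∀ φ, B φ = ∑ y ∈ F, φ y • V y := fun φ => by
    simp only [B, _root_.sum_apply, ContinuousLinearMap.smulRight_apply, innerSL_apply_apply,
      inner_delta]
  have hBdelta : ∀ x, B (delta x) = if x ∈ F then V x else 0 := fun x => by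
    simp only [hB, delta_apply, ite_smul, one_smul, zero_smul, Finset.sum_ite_eq']
  have hgraph : ∀ φ, (cutoff (F : Set (Site N)) φ, B φ) ∈ A.graph := fun φ => by
    have h := Submodule.sum_mem A.graph fun y hy => Submodule.smul_mem _ (φ y) (hV y hy)
    rwa [show ∑ y ∈ F, φ y • ((delta y : Hdisc N), V y) = (cutoff (F : Set (Site N)) φ, B φ) by
      rw [cutoff_finset_eq_sum, hB]
      exact Prod.ext (by simp [Prod.fst_sum]) (by simp [Prod.snd_sum])] at h
  have ht := hasTrace_compression hgraph
    (summable_of_ne_finset_zero (s := F) fun x hx => by simp [hBdelta, hx])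
  rw [tsum_eq_sum (s := F) fun x hx => by simp [hx]] at ht
  convert ht using 1
  exact Finset.sum_congr rfl fun y hy => by simp [hy, entry, hBdelta]

theorem HasTrace.unique {A : Hdisc N →ₗ.[ℂ] Hdisc N} {s t : ℂ} (hs : HasTrace A s)
    (ht : HasTrace A t) : s = t := by
  obtain ⟨B, rfl, -, hB⟩ := hs
  obtain ⟨B', hBB', -, hB'⟩ := ht
  obtain rfl : B = B' := by
    ext1 φ
    exact LinearPMap.mem_graph_snd_inj _ (mem_graph_ofBounded B φ)
      (hBB' ▸ mem_graph_ofBounded B' φ) rfl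
  exact hB.unique hB'

theorem HasDirPVTrace.unique {j : Fin 2} {A : Hdisc N →ₗ.[ℂ] Hdisc N} {s t : ℂ}
    (hs : HasDirPVTrace j A s) (ht : HasDirPVTrace j A t) : s = t := by
  obtain ⟨f, hf, hfs⟩ := hs
  obtain ⟨f', hf', hft⟩ := ht
  obtain rfl : f = f' := funext fun k => (hf k).unique (hf' k)
  exact tendsto_nhds_unique hfs hft

/-! ### Polynomial approximation of spectral projections -/

section Approximation

open Polynomial

/-- The probability that at most `n` out of `2 n + 1` independent trials succeed, as a polynomial
in the probability of success. It approximates the characteristic function of `x < 1 / 2`. -/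
def minorityPoly (n : ℕ) : ℝ[X] :=
  ∑ k ∈ Finset.range (n + 1), bernsteinPolynomial ℝ (2 * n + 1) k

theorem minorityPoly_eval (n : ℕ) (x : ℝ) : (minorityPoly n).eval x =
    ∑ k ∈ Finset.range (n + 1), ((2 * n + 1).choose k : ℝ) * x ^ k * (1 - x) ^ (2 * n + 1 - k) := by
  simp [minorityPoly, bernsteinPolynomial, eval_finsetSum]

theorem minorityPoly_eval_one_sub (n : ℕ) (x : ℝ) :
    (minorityPoly n).eval (1 - x) = 1 - (minorityPoly n).eval x := by
  have hflip : (minorityPoly n).comp (1 - .X) =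
      ∑ k ∈ Finset.range (n + 1), bernsteinPolynomial ℝ (2 * n + 1) (n + 1 + k) := by
    rw [minorityPoly, sum_comp, ← Finset.sum_range_reflect]
    refine Finset.sum_congr rfl fun k hk => ?_
    have hk' := Finset.mem_range.1 hk
    rw [bernsteinPolynomial.flip _ _ _ (by lia)]
    congr 1
    lia
  have hsum : minorityPoly n + (minorityPoly n).comp (1 - .X) = 1 := by
    rw [hflip, minorityPoly, ← Finset.sum_range_add, ← bernsteinPolynomial.sum ℝ (2 * n + 1)]
    congr 2
    lia
  have h := congrArg (eval x) hsum
  simp only [eval_add, eval_comp, eval_sub, eval_one, eval_X] at h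
  exact eq_sub_of_add_eq' h

theorem minorityPoly_eval_nonneg (n : ℕ) {x : ℝ} (h0 : 0 ≤ x) (h1 : x ≤ 1) :
    0 ≤ (minorityPoly n).eval x := by
  rw [minorityPoly_eval]
  have := sub_nonneg.2 h1
  positivity

theorem minorityPoly_eval_le (n : ℕ) {x : ℝ} (h0 : 1 / 2 ≤ x) (h1 : x ≤ 1) :
    (minorityPoly n).eval x ≤ (4 * x * (1 - x)) ^ n := by
  have hx : 0 ≤ 1 - x := sub_nonneg.2 h1
  have hterm : ∀ k ∈ Finset.range (n + 1),
      ((2 * n + 1).choose k : ℝ) * x ^ k * (1 - x) ^ (2 * n + 1 - k) ≤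
        ((2 * n + 1).choose k : ℝ) * (x * (1 - x)) ^ n := fun k hk => by
    obtain ⟨j, rfl⟩ := Nat.exists_eq_add_of_le (Nat.lt_succ_iff.1 (Finset.mem_range.1 hk))
    rw [mul_assoc, show 2 * (k + j) + 1 - k = (k + j) + (j + 1) by lia, pow_add (1 - x), mul_pow,
      mul_left_comm (x ^ k), mul_comm (x ^ (k + j)), pow_add x]
    gcongr
    calc (1 - x) ^ (j + 1) ≤ (1 - x) ^ j := pow_le_pow_of_le_one hx (by linarith) j.le_succ
      _ ≤ x ^ j := by gcongr; linarith
  calc (minorityPoly n).eval x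
      ≤ ∑ k ∈ Finset.range (n + 1), ((2 * n + 1).choose k : ℝ) * (x * (1 - x)) ^ n := by
        rw [minorityPoly_eval]; exact Finset.sum_le_sum hterm
    _ = (4 * x * (1 - x)) ^ n := by
        rw [← Finset.sum_mul, ← Nat.cast_sum, Nat.sum_range_choose_halfway, Nat.cast_pow,
          ← mul_pow, Nat.cast_ofNat, mul_assoc]

theorem abs_indicator_sub_minorityPoly_eval_le (n : ℕ) {x : ℝ} (h0 : 0 ≤ x) (h1 : x ≤ 1) :
    |(Set.Iio (1 / 2)).indicator (fun _ => (1 : ℝ)) x - (minorityPoly n).eval x| ≤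
      (4 * x * (1 - x)) ^ n := by
  rcases lt_or_ge x (1 / 2) with hx | hx
  · have hx' : 0 ≤ 1 - x ∧ 1 - x ≤ 1 := ⟨by linarith, by linarith⟩
    rw [Set.indicator_of_mem (Set.mem_Iio.2 hx), ← minorityPoly_eval_one_sub,
      abs_of_nonneg (minorityPoly_eval_nonneg n hx'.1 hx'.2)]
    refine (minorityPoly_eval_le n (by linarith) hx'.2).trans_eq ?_
    ring
  · rw [Set.indicator_of_notMem (by simpa using hx), zero_sub, abs_neg,
      abs_of_nonneg (minorityPoly_eval_nonneg n h0 h1)]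
    exact minorityPoly_eval_le n hx h1

variable {E : Type*} [NormedAddCommGroup E] [InnerProductSpace ℂ E] [CompleteSpace E]

theorem continuousOn_indicator_Iio {s : Set ℝ} {μ : ℝ} (hμ : μ ∉ s) :
    ContinuousOn ((Set.Iio μ).indicator fun _ => (1 : ℝ)) s := fun x hx =>
  (continuousOn_const.continuousAt_indicator (by
    rw [frontier_Iio, Set.mem_singleton_iff]
    exact fun h => hμ (h ▸ hx))).continuousWithinAt

theorem isStarProjection_spectralProjBelow {H : E →L[ℂ] E} {μ : ℝ} (hμ : μ ∉ spectrum ℝ H) :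
    IsStarProjection (spectralProjBelow H μ) := by
  refine ⟨?_, cfc_predicate _ _⟩
  have hc := continuousOn_indicator_Iio hμ
  rw [IsIdempotentElem, spectralProjBelow, ← cfc_mul _ _ H hc hc]
  congr 1
  funext x
  by_cases hx : x ∈ Set.Iio μ <;> simp [hx]

/-- The affine function `x ↦ 1 / 2 + s (x - μ)` with `s = 1 / (2 R)` maps a neighbourhood of `μ` of
radius `R` into `[0, 1]` and `μ` to the threshold `1 / 2`. -/
theorem abs_indicator_sub_minorityPoly_eval_affine_le {δ R x μ : ℝ} (hδ : 0 < δ)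
    (hxδ : δ ≤ |x - μ|) (hxR : |x - μ| ≤ R) (n : ℕ) :
    |(Set.Iio μ).indicator (fun _ => (1 : ℝ)) x -
      (minorityPoly n).eval (1 / 2 + (2 * R)⁻¹ * (x - μ))| ≤ (1 - (δ / R) ^ 2) ^ n := by
  have hR : 0 < R := hδ.trans_le (hxδ.trans hxR)
  set y := (x - μ) / R with hy
  have hyabs : |y| = |x - μ| / R := by rw [hy, abs_div, abs_of_pos hR]
  have hy1 : |y| ≤ 1 := by rwa [hyabs, div_le_one hR]
  have hyδ : δ / R ≤ |y| := by rw [hyabs]; gcongr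
  obtain ⟨hy1, hy1'⟩ := abs_le.1 hy1
  have hind : (Set.Iio μ).indicator (fun _ => (1 : ℝ)) x =
      (Set.Iio (1 / 2)).indicator (fun _ => (1 : ℝ)) (1 / 2 + y / 2) := by
    have h : x < μ ↔ 1 / 2 + y / 2 < 1 / 2 := by
      rw [add_lt_iff_neg_left, div_neg_iff]
      simp [hy, div_neg_iff, hR, hR.not_gt]
    simp only [Set.indicator_apply, Set.mem_Iio, h]
  rw [show 1 / 2 + (2 * R)⁻¹ * (x - μ) = 1 / 2 + y / 2 by rw [hy]; field_simp, hind]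
  refine (abs_indicator_sub_minorityPoly_eval_le n (by linarith) (by linarith)).trans ?_
  rw [show 4 * (1 / 2 + y / 2) * (1 - (1 / 2 + y / 2)) = 1 - |y| ^ 2 by rw [sq_abs]; ring]
  gcongr
  rw [sub_nonneg, sq_abs]
  nlinarith

theorem exists_norm_spectralProjBelow_sub_aeval_le {H : E →L[ℂ] E} (hH : IsSelfAdjoint H)
    {μ : ℝ} (hμ : μ ∉ spectrum ℝ H) :
    ∃ s a : ℝ, 0 < a ∧ a < 1 ∧ ∀ n, ‖spectralProjBelow H μ -
      aeval (algebraMap ℝ _ (1 / 2) + s • (H - algebraMap ℝ _ μ)) (minorityPoly n)‖ ≤ a ^ n := by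
  obtain ⟨δ, hδ, hball⟩ := Metric.isOpen_iff.1 (spectrum.isClosed (𝕜 := ℝ) H).isOpen_compl μ hμ
  obtain ⟨R, hR, hclosedBall⟩ :=
    (spectrum.isCompact (𝕜 := ℝ) H).isBounded.subset_closedBall_lt δ μ
  have hq0 : 0 < δ / R := div_pos hδ (hδ.trans hR)
  have hq1 : δ / R < 1 := (div_lt_one (hδ.trans hR)).2 hR
  refine ⟨(2 * R)⁻¹, 1 - (δ / R) ^ 2, by nlinarith, by nlinarith, fun n => ?_⟩
  let q : ℝ[X] := .C (1 / 2) + .C (2 * R)⁻¹ * (.X - .C μ)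
  have hq : algebraMap ℝ _ (1 / 2) + (2 * R)⁻¹ • (H - algebraMap ℝ _ μ) = aeval H q := by
    simp only [q, map_add, map_mul, map_sub, aeval_C, aeval_X, Algebra.smul_def]
  rw [hq, ← aeval_comp, ← cfc_polynomial _ H hH, spectralProjBelow,
    ← cfc_sub _ _ H (continuousOn_indicator_Iio hμ) (Polynomial.continuous _).continuousOn]
  refine norm_cfc_le (pow_nonneg (by nlinarith) n) fun x hx => ?_
  have hxδ : δ ≤ |x - μ| := not_lt.1 fun h => hball h hx
  have hxR : |x - μ| ≤ R := hclosedBall hx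
  rw [eval_comp, show q.eval x = 1 / 2 + (2 * R)⁻¹ * (x - μ) by simp [q], Real.norm_eq_abs]
  exact abs_indicator_sub_minorityPoly_eval_affine_le hδ hxδ hxR n

end Approximation

theorem HasSpectralGap.notMem_spectrum {A : Hdisc N →L[ℂ] Hdisc N} {a b μ : ℝ}
    (h : HasSpectralGap A a b) (hμ : μ ∈ Set.Ioo a b) : μ ∉ spectrum ℝ A := by
  obtain ⟨I₁, I₂, -, -, hs, ha, -, hb⟩ := h
  have hspec : spectrum ℝ A = I₁ ∪ I₂ := by
    rw [← spectrum.preimage_algebraMap ℂ, hs]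
    exact Set.preimage_image_eq _ Complex.ofReal_injective
  have hbdd : Bornology.IsBounded (I₁ ∪ I₂) := hspec ▸ (spectrum.isCompact A).isBounded
  rw [hspec]
  rintro (h | h)
  · have := le_csSup (hbdd.subset Set.subset_union_left).bddAbove h
    linarith [hμ.1]
  · have := csInf_le (hbdd.subset Set.subset_union_right).bddBelow h
    linarith [hμ.2]

/-! ### Weighted column norms -/

section ColumnNorm

variable {G ι : Type*} [AddGroup G] {w : G → ℝ≥0∞}

/-- The norm of a kernel as an operator on the weighted `ℓ¹` spaces centred at the lattice points:
`sup_y ∑_x r(x, y) w(x - y)`, where `w` only sees the lattice component. For a submultiplicative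
weight it is submultiplicative. -/
def colNorm (w : G → ℝ≥0∞) (r : G × ι → G × ι → ℝ≥0∞) : ℝ≥0∞ :=
  ⨆ y, ∑' x, r x y * w (x.1 - y.1)

theorem tsum_le_colNorm (r : G × ι → G × ι → ℝ≥0∞) (y : G × ι) :
    ∑' x, r x y * w (x.1 - y.1) ≤ colNorm w r :=
  le_iSup (fun y : G × ι => ∑' x, r x y * w (x.1 - y.1)) y

theorem mul_weight_le_colNorm (r : G × ι → G × ι → ℝ≥0∞) (x y : G × ι) :
    r x y * w (x.1 - y.1) ≤ colNorm w r :=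
  (ENNReal.le_tsum (f := fun x => r x y * w (x.1 - y.1)) x).trans (tsum_le_colNorm r y)

theorem tsum_tsum_mul_weight_le (hw : ∀ m n, w (m + n) ≤ w m * w n)
    (r : G × ι → G × ι → ℝ≥0∞) (f : G × ι → ℝ≥0∞) (m : G) :
    ∑' x, (∑' u, r x u * f u) * w (x.1 - m) ≤ colNorm w r * ∑' u, f u * w (u.1 - m) := by
  calc ∑' x, (∑' u, r x u * f u) * w (x.1 - m)
      = ∑' u, ∑' x, r x u * f u * w (x.1 - m) := by
        simp only [← ENNReal.tsum_mul_right]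
        exact ENNReal.tsum_comm
    _ ≤ ∑' u, ∑' x, r x u * w (x.1 - u.1) * (f u * w (u.1 - m)) := by
        refine ENNReal.tsum_le_tsum fun u => ENNReal.tsum_le_tsum fun x => ?_
        calc r x u * f u * w (x.1 - m) = r x u * f u * w ((x.1 - u.1) + (u.1 - m)) := by
              rw [sub_add_sub_cancel]
          _ ≤ r x u * f u * (w (x.1 - u.1) * w (u.1 - m)) := by gcongr; exact hw _ _
          _ = r x u * w (x.1 - u.1) * (f u * w (u.1 - m)) := by ring
    _ = ∑' u, (∑' x, r x u * w (x.1 - u.1)) * (f u * w (u.1 - m)) := by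
        simp only [ENNReal.tsum_mul_right]
    _ ≤ ∑' u, colNorm w r * (f u * w (u.1 - m)) :=
        ENNReal.tsum_le_tsum fun u => mul_le_mul_left (tsum_le_colNorm r u) _
    _ = colNorm w r * ∑' u, f u * w (u.1 - m) := ENNReal.tsum_mul_left

theorem colNorm_ne_top_of_le [Finite ι] {r : G × ι → G × ι → ℝ≥0∞} {d : G → ℝ≥0∞}
    (h : ∀ x y, r x y ≤ d (x.1 - y.1)) (hd : ∑' n, d n * w n ≠ ∞) : colNorm w r ≠ ∞ := by
  have := Fintype.ofFinite ι
  refine ne_top_of_le_ne_top (b := ∑ _ : ι, ∑' n, d n * w n) (by simp [hd, ENNReal.mul_eq_top]) ?_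
  refine iSup_le fun y => ?_
  calc ∑' x, r x y * w (x.1 - y.1) ≤ ∑' x : G × ι, d (x.1 - y.1) * w (x.1 - y.1) :=
        ENNReal.tsum_le_tsum fun x => mul_le_mul_left (h x y) _
    _ = ∑' _ : ι, ∑' n, d (n - y.1) * w (n - y.1) := by
        rw [ENNReal.tsum_prod', ENNReal.tsum_comm]
    _ = ∑ _ : ι, ∑' n, d n * w n := by
        rw [tsum_fintype]
        exact Finset.sum_congr rfl fun _ _ =>
          (Equiv.subRight y.1).tsum_eq fun n => d n * w n

end ColumnNorm

/-- The kernel of absolute values `|⟨δ_x, A δ_y⟩|`. -/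
def absEntry (A : Hdisc N →L[ℂ] Hdisc N) (x y : Site N) : ℝ≥0∞ := ‖entry A x y‖ₑ

theorem enorm_apply_le (A : Hdisc N →L[ℂ] Hdisc N) (φ : Hdisc N) (x : Site N) :
    ‖A φ x‖ₑ ≤ ∑' u, absEntry A x u * ‖φ u‖ₑ := by
  simp only [absEntry, ← enorm_mul]
  rw [apply_eq_tsum]
  exact enorm_tsum_le_tsum_enorm

section OperatorColumnNorm

variable {w : Lattice → ℝ≥0∞}

theorem tsum_enorm_apply_mul_weight_le (hw : ∀ m n, w (m + n) ≤ w m * w n)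
    (A : Hdisc N →L[ℂ] Hdisc N) (φ : Hdisc N) (m : Lattice) :
    ∑' x, ‖A φ x‖ₑ * w (x.1 - m) ≤ colNorm w (absEntry A) * ∑' u, ‖φ u‖ₑ * w (u.1 - m) :=
  (ENNReal.tsum_le_tsum fun x => mul_le_mul_left (enorm_apply_le A φ x) _).trans
    (tsum_tsum_mul_weight_le hw _ _ m)

theorem colNorm_mul_le (hw : ∀ m n, w (m + n) ≤ w m * w n) (A B : Hdisc N →L[ℂ] Hdisc N) :
    colNorm w (absEntry (A * B)) ≤ colNorm w (absEntry A) * colNorm w (absEntry B) :=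
  iSup_le fun y => (tsum_enorm_apply_mul_weight_le hw A (B (delta y)) y.1).trans
    (mul_le_mul_right (tsum_le_colNorm (absEntry B) y) _)

theorem colNorm_add_le (A B : Hdisc N →L[ℂ] Hdisc N) :
    colNorm w (absEntry (A + B)) ≤ colNorm w (absEntry A) + colNorm w (absEntry B) := by
  refine iSup_le fun y => ?_
  calc ∑' x, absEntry (A + B) x y * w (x.1 - y.1)
      ≤ ∑' x, (absEntry A x y * w (x.1 - y.1) + absEntry B x y * w (x.1 - y.1)) := by
        refine ENNReal.tsum_le_tsum fun x => ?_
        rw [← add_mul]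
        gcongr
        exact enorm_add_le _ _
    _ = _ := ENNReal.tsum_add
    _ ≤ _ := add_le_add (tsum_le_colNorm _ y) (tsum_le_colNorm _ y)

theorem colNorm_smul (c : ℝ) (A : Hdisc N →L[ℂ] Hdisc N) :
    colNorm w (absEntry (c • A)) = ‖c‖ₑ * colNorm w (absEntry A) := by
  have h : ∀ x y, absEntry (c • A) x y = ‖c‖ₑ * absEntry A x y := fun x y =>
    (enorm_smul c (entry A x y) :)
  simp only [colNorm, h, mul_assoc, ENNReal.tsum_mul_left, ENNReal.mul_iSup]

theorem colNorm_one_le (h0 : w 0 ≤ 1) :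
    colNorm w (absEntry (1 : Hdisc N →L[ℂ] Hdisc N)) ≤ 1 := by
  refine iSup_le fun y => ?_
  rw [tsum_eq_single y fun x hx => by simp [absEntry, entry, delta_apply, hx]]
  simpa [absEntry, entry, delta_apply] using h0

theorem colNorm_one_sub_le (h0 : w 0 ≤ 1) (A : Hdisc N →L[ℂ] Hdisc N) :
    colNorm w (absEntry (1 - A)) ≤ 1 + colNorm w (absEntry A) := by
  rw [sub_eq_add_neg, ← neg_one_smul ℝ A]
  refine (colNorm_add_le _ _).trans (add_le_add (colNorm_one_le h0) ?_)
  rw [colNorm_smul, enorm_neg, enorm_one, one_mul]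

theorem colNorm_algebraMap_ne_top (h0 : w 0 ≤ 1) (c : ℝ) :
    colNorm w (absEntry (algebraMap ℝ (Hdisc N →L[ℂ] Hdisc N) c)) ≠ ∞ := by
  rw [Algebra.algebraMap_eq_smul_one, colNorm_smul]
  exact ENNReal.mul_ne_top enorm_ne_top (ne_top_of_le_ne_top ENNReal.one_ne_top (colNorm_one_le h0))

theorem colNorm_pow_le (hw : ∀ m n, w (m + n) ≤ w m * w n) (h0 : w 0 ≤ 1)
    (A : Hdisc N →L[ℂ] Hdisc N) (k : ℕ) :
    colNorm w (absEntry (A ^ k)) ≤ colNorm w (absEntry A) ^ k := by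
  induction k with
  | zero => simpa using colNorm_one_le h0
  | succ k ih =>
    rw [pow_succ, pow_succ]
    exact (colNorm_mul_le hw _ _).trans (mul_le_mul_left ih _)

theorem colNorm_sum_le {κ : Type*} (s : Finset κ) (A : κ → Hdisc N →L[ℂ] Hdisc N) :
    colNorm w (absEntry (∑ i ∈ s, A i)) ≤ ∑ i ∈ s, colNorm w (absEntry (A i)) :=
  Finset.le_sum_of_subadditive (fun A => colNorm w (absEntry A))
    (by simp [colNorm, absEntry, entry]) colNorm_add_le s A

theorem colNorm_aeval_bernsteinPolynomial_le (hw : ∀ m n, w (m + n) ≤ w m * w n) (h0 : w 0 ≤ 1)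
    (A : Hdisc N →L[ℂ] Hdisc N) {n k : ℕ} (hk : k ≤ n) :
    colNorm w (absEntry (Polynomial.aeval A (bernsteinPolynomial ℝ n k))) ≤
      n.choose k * (1 + colNorm w (absEntry A)) ^ n := by
  have haeval : Polynomial.aeval A (bernsteinPolynomial ℝ n k) =
      (n.choose k : ℝ) • (A ^ k * (1 - A) ^ (n - k)) := by
    simp [bernsteinPolynomial, Algebra.smul_def, mul_assoc]
  rw [haeval, colNorm_smul, Real.enorm_natCast]
  gcongr
  refine (colNorm_mul_le hw _ _).trans ?_
  calc colNorm w (absEntry (A ^ k)) * colNorm w (absEntry ((1 - A) ^ (n - k)))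
      ≤ (1 + colNorm w (absEntry A)) ^ k * (1 + colNorm w (absEntry A)) ^ (n - k) := by
        gcongr
        · exact (colNorm_pow_le hw h0 A k).trans (by gcongr; exact le_add_self)
        · exact (colNorm_pow_le hw h0 _ _).trans (by gcongr; exact colNorm_one_sub_le h0 A)
    _ = (1 + colNorm w (absEntry A)) ^ n := by rw [← pow_add, Nat.add_sub_cancel' hk]

theorem colNorm_aeval_minorityPoly_le (hw : ∀ m n, w (m + n) ≤ w m * w n) (h0 : w 0 ≤ 1)
    (A : Hdisc N →L[ℂ] Hdisc N) (n : ℕ) :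
    colNorm w (absEntry (Polynomial.aeval A (minorityPoly n))) ≤
      4 ^ n * (1 + colNorm w (absEntry A)) ^ (2 * n + 1) := by
  rw [minorityPoly, map_sum]
  refine (colNorm_sum_le _ _).trans ?_
  calc ∑ k ∈ Finset.range (n + 1),
        colNorm w (absEntry (Polynomial.aeval A (bernsteinPolynomial ℝ (2 * n + 1) k)))
      ≤ ∑ k ∈ Finset.range (n + 1),
        ((2 * n + 1).choose k : ℝ≥0∞) * (1 + colNorm w (absEntry A)) ^ (2 * n + 1) :=
        Finset.sum_le_sum fun k hk => colNorm_aeval_bernsteinPolynomial_le hw h0 A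
          (by have := Finset.mem_range.1 hk; lia)
    _ = 4 ^ n * (1 + colNorm w (absEntry A)) ^ (2 * n + 1) := by
        rw [← Finset.sum_mul, ← Nat.cast_sum, Nat.sum_range_choose_halfway, Nat.cast_pow,
          Nat.cast_ofNat]

end OperatorColumnNorm

/-- Take `n = ⌊ε t⌋` with `ε` so small that `F ^ n` does not spoil half of the decay rate `c`. -/
theorem exists_exp_decay_of_forall_le {K a F c : ℝ} (hK : 0 ≤ K) (ha0 : 0 < a) (ha1 : a < 1)
    (hF : 1 ≤ F) (hc : 0 < c) :
    ∃ C c' : ℝ, 0 < c' ∧ ∀ t v : ℝ, 0 ≤ t →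
      (∀ n : ℕ, v ≤ a ^ n + K * F ^ n * Real.exp (-c * t)) → v ≤ C * Real.exp (-c' * t) := by
  have hlogF : 0 ≤ Real.log F := Real.log_nonneg hF
  have hloga : Real.log a < 0 := Real.log_neg ha0 ha1
  set ε : ℝ := c / (2 * (Real.log F + 1)) with hε
  have hε0 : 0 < ε := by positivity
  have hεF : ε * Real.log F ≤ c / 2 := by
    rw [hε, div_mul_eq_mul_div, div_le_div_iff₀ (by positivity) (by positivity)]
    nlinarith
  set c' : ℝ := min (c / 2) (ε * -Real.log a)
  have hc'c : c' ≤ c / 2 := min_le_left _ _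
  have hc'a : c' ≤ ε * -Real.log a := min_le_right _ _
  refine ⟨a⁻¹ + K, c', lt_min (by positivity) (mul_pos hε0 (neg_pos.2 hloga)),
    fun t v ht hv => (hv ⌊ε * t⌋₊).trans ?_⟩
  have hle : (⌊ε * t⌋₊ : ℝ) ≤ ε * t := Nat.floor_le (by positivity)
  have hlt : ε * t < ⌊ε * t⌋₊ + 1 := Nat.lt_floor_add_one _
  set n := ⌊ε * t⌋₊
  have hgeom : a ^ n ≤ a⁻¹ * Real.exp (-c' * t) := by
    rw [← Real.exp_log ha0, ← Real.exp_nat_mul, ← Real.exp_neg, ← Real.exp_add,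
      Real.exp_le_exp]
    have : c' * t ≤ ε * -Real.log a * t := by gcongr
    nlinarith
  have hexp : F ^ n * Real.exp (-c * t) ≤ Real.exp (-c' * t) := by
    rw [← Real.exp_log (by linarith : 0 < F), ← Real.exp_nat_mul, ← Real.exp_add,
      Real.exp_le_exp]
    have hnF : (n : ℝ) * Real.log F ≤ ε * Real.log F * t := by
      rw [mul_right_comm]
      gcongr
    have hεt : ε * Real.log F * t ≤ c / 2 * t := by gcongr
    have hc't : c' * t ≤ c / 2 * t := by gcongr
    linarith
  calc a ^ n + K * F ^ n * Real.exp (-c * t)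
      ≤ a⁻¹ * Real.exp (-c' * t) + K * Real.exp (-c' * t) := by
        rw [mul_assoc K]
        gcongr
    _ = (a⁻¹ + K) * Real.exp (-c' * t) := by ring

/-! ### Exponential and polynomial weights -/

section Weights

variable {G : Type*} [SeminormedAddCommGroup G]

/-- The weight `exp (c ‖n‖)`, which measures exponential decay of a kernel. -/
def expWeight (c : ℝ) (n : G) : ℝ≥0∞ := ENNReal.ofReal (Real.exp (c * ‖n‖))

theorem expWeight_zero_le_one (c : ℝ) : expWeight c (0 : G) ≤ 1 := by simp [expWeight]

theorem expWeight_add_le {c : ℝ} (hc : 0 ≤ c) (m n : G) :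
    expWeight c (m + n) ≤ expWeight c m * expWeight c n := by
  rw [expWeight, expWeight, expWeight, ← ENNReal.ofReal_mul (Real.exp_nonneg _), ← Real.exp_add,
    ← mul_add]
  gcongr
  exact norm_add_le m n

/-- The weight `(1 + ‖n‖) ^ k`, which measures the moments of a kernel. -/
def polyWeight (k : ℕ) (n : G) : ℝ≥0∞ := (1 + ‖n‖ₑ) ^ k

theorem polyWeight_eq_ofReal (k : ℕ) (n : G) :
    polyWeight k n = ENNReal.ofReal ((1 + ‖n‖) ^ k) := by
  rw [polyWeight, ENNReal.ofReal_pow (by positivity), ENNReal.ofReal_add zero_le_one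
    (norm_nonneg _), ENNReal.ofReal_one, ofReal_norm]

theorem polyWeight_add_le (k : ℕ) (m n : G) :
    polyWeight k (m + n) ≤ polyWeight k m * polyWeight k n := by
  rw [polyWeight, polyWeight, polyWeight, ← mul_pow]
  gcongr
  calc 1 + ‖m + n‖ₑ ≤ 1 + (‖m‖ₑ + ‖n‖ₑ) := by
        simp only [← ofReal_norm, ← ENNReal.ofReal_add (norm_nonneg m) (norm_nonneg n)]
        gcongr
        exact norm_add_le m n
    _ ≤ 1 + (‖m‖ₑ + ‖n‖ₑ) + ‖m‖ₑ * ‖n‖ₑ := le_self_add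
    _ = (1 + ‖m‖ₑ) * (1 + ‖n‖ₑ) := by ring

end Weights

theorem one_add_pow_mul_exp_le {c t : ℝ} (hc : 0 < c) (ht : 0 ≤ t) (k : ℕ) :
    (1 + t) ^ k * Real.exp (-c * t) ≤ k.factorial / c ^ k * Real.exp c := by
  have h := Real.pow_div_factorial_le_exp (c * (1 + t)) (by positivity) k
  rw [mul_pow, div_le_iff₀ (by positivity)] at h
  rw [show c = c * (1 + t) + -c * t by ring, Real.exp_add, ← mul_assoc,
    show c * (1 + t) + -c * t = c by ring]
  gcongr
  rw [div_mul_eq_mul_div, le_div_iff₀ (by positivity)]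
  linarith

theorem summable_one_add_norm_pow_mul_exp {c : ℝ} (hc : 0 < c) (k : ℕ) :
    Summable fun n : Lattice => (1 + ‖n‖) ^ k * Real.exp (-c * ‖n‖) := by
  refine Summable.of_norm_bounded_eventually
    ((EisensteinSeries.summable_one_div_norm_rpow (k := 3) (by norm_num)).mul_left
      ((k + 3).factorial / c ^ (k + 3) * Real.exp c))
    ((Set.finite_singleton (0 : Lattice)).subset fun n hn => ?_)
  by_contra h0
  refine hn ?_
  have hpos : 0 < ‖n‖ := norm_pos_iff.2 h0
  change ‖(1 + ‖n‖) ^ k * Real.exp (-c * ‖n‖)‖ ≤ _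
  rw [Real.norm_of_nonneg (by positivity), Real.rpow_neg hpos.le, ← div_eq_mul_inv,
    le_div_iff₀ (by positivity)]
  norm_cast
  calc (1 + ‖n‖) ^ k * Real.exp (-c * ‖n‖) * ‖n‖ ^ 3
      ≤ (1 + ‖n‖) ^ k * Real.exp (-c * ‖n‖) * (1 + ‖n‖) ^ 3 := by gcongr; linarith
    _ = (1 + ‖n‖) ^ (k + 3) * Real.exp (-c * ‖n‖) := by ring
    _ ≤ (k + 3).factorial / c ^ (k + 3) * Real.exp c := one_add_pow_mul_exp_le hc hpos.le _

section ExponentialDecay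

variable {A : Hdisc N →L[ℂ] Hdisc N} {C c : ℝ}

theorem colNorm_ne_top_of_norm_entry_le
    (h : ∀ x y, ‖entry A x y‖ ≤ C * Real.exp (-c * ‖x.1 - y.1‖)) {v : Lattice → ℝ}
    (hv : ∀ n, 0 ≤ v n) (hs : Summable fun n => v n * Real.exp (-c * ‖n‖)) :
    colNorm (fun n => ENNReal.ofReal (v n)) (absEntry A) ≠ ∞ := by
  refine colNorm_ne_top_of_le (d := fun n => ENNReal.ofReal (C * Real.exp (-c * ‖n‖)))
    (fun x y => ?_) ?_
  · rw [absEntry, ← ofReal_norm]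
    exact ENNReal.ofReal_le_ofReal (h x y)
  · simp only [← ENNReal.ofReal_mul' (hv _)]
    exact ((hs.mul_left C).congr fun n => by ring).tsum_ofReal_ne_top

theorem colNorm_polyWeight_ne_top (hc : 0 < c)
    (h : ∀ x y, ‖entry A x y‖ ≤ C * Real.exp (-c * ‖x.1 - y.1‖)) (k : ℕ) :
    colNorm (polyWeight k) (absEntry A) ≠ ∞ := by
  rw [funext (polyWeight_eq_ofReal (G := Lattice) k)]
  exact colNorm_ne_top_of_norm_entry_le h (fun n => by positivity)
    (summable_one_add_norm_pow_mul_exp hc k)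

theorem colNorm_expWeight_half_ne_top (hc : 0 < c)
    (h : ∀ x y, ‖entry A x y‖ ≤ C * Real.exp (-c * ‖x.1 - y.1‖)) :
    colNorm (expWeight (c / 2)) (absEntry A) ≠ ∞ := by
  refine colNorm_ne_top_of_norm_entry_le h (fun n => (Real.exp_pos _).le)
    ((summable_one_add_norm_pow_mul_exp (half_pos hc) 0).congr fun n => ?_)
  rw [pow_zero, one_mul, ← Real.exp_add]
  congr 1
  ring

theorem norm_entry_le_of_colNorm_le {K : ℝ} (hK : 0 ≤ K)
    (h : colNorm (expWeight c) (absEntry A) ≤ ENNReal.ofReal K) (x y : Site N) :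
    ‖entry A x y‖ ≤ K * Real.exp (-c * ‖x.1 - y.1‖) := by
  have hxy := (mul_weight_le_colNorm (absEntry A) x y).trans h
  rw [absEntry, expWeight, ← ofReal_norm, ← ENNReal.ofReal_mul (norm_nonneg _),
    ENNReal.ofReal_le_ofReal_iff hK] at hxy
  rwa [neg_mul, Real.exp_neg, ← div_eq_mul_inv, le_div_iff₀ (Real.exp_pos _)]

end ExponentialDecay

theorem norm_entry_le_norm_toEuclideanCLM {ι : Type*} [Fintype ι] [DecidableEq ι]
    (M : Matrix ι ι ℂ) (i k : ι) : ‖M i k‖ ≤ ‖Matrix.toEuclideanCLM (𝕜 := ℂ) M‖ := by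
  have h := (Matrix.toEuclideanCLM (𝕜 := ℂ) M).le_opNorm (EuclideanSpace.single k 1)
  rw [PiLp.norm_single, norm_one, mul_one] at h
  refine le_trans ?_ ((PiLp.norm_apply_le _ i).trans h)
  simp [EuclideanSpace.single]

theorem norm_le_sum_abs_sub (m n : Lattice) : ‖m - n‖ ≤ ∑ j, |(m j : ℝ) - n j| :=
  (pi_norm_le_iff_of_nonneg (Finset.sum_nonneg fun _ _ => abs_nonneg _)).2 fun j => by
    simpa [Int.norm_eq_abs] using Finset.single_le_sum (f := fun j => |(m j : ℝ) - n j|)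
      (fun _ _ => abs_nonneg _) (Finset.mem_univ j)

theorem IsNearSighted.norm_entry_le {A : Hdisc N →L[ℂ] Hdisc N} (h : IsNearSighted A) :
    ∃ C c : ℝ, 0 < c ∧ ∀ x y, ‖entry A x y‖ ≤ C * Real.exp (-c * ‖x.1 - y.1‖) := by
  obtain ⟨C, ζ, hC, hζ, hA⟩ := h
  refine ⟨C, 1 / ζ, by positivity, fun ⟨m, i⟩ ⟨n, k⟩ => ?_⟩
  calc ‖entry A (m, i) (n, k)‖
      ≤ ‖Matrix.toEuclideanCLM (𝕜 := ℂ) (kernel (ofBounded A) m n)‖ := by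
        rw [← kernel_ofBounded]
        exact norm_entry_le_norm_toEuclideanCLM _ i k
    _ ≤ C * Real.exp (-(1 / ζ) * ∑ j, |(m j : ℝ) - n j|) := hA m n
    _ ≤ C * Real.exp (-(1 / ζ) * ‖m - n‖) := by
        have := norm_le_sum_abs_sub m n
        rw [neg_mul, neg_mul]
        gcongr

/-! ### Periodic kernels -/

/-- Translation of the sites by a lattice vector. -/
def translate (p : Lattice) : Site N ≃ Site N := (Equiv.addRight p).prodCongr (Equiv.refl _)

@[simp]
theorem translate_fst (p : Lattice) (x : Site N) : (translate p x).1 = x.1 + p := rfl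

@[simp]
theorem translate_snd (p : Lattice) (x : Site N) : (translate p x).2 = x.2 := rfl

theorem translate_zero_mk (n : Lattice) (i : Internal N) : translate n (0, i) = (n, i) := by
  ext <;> simp

theorem entry_star (A : Hdisc N →L[ℂ] Hdisc N) (x y : Site N) :
    entry (star A) x y = star (entry A y x) := by
  rw [entry_eq_inner, entry_eq_inner, ContinuousLinearMap.star_eq_adjoint,
    ContinuousLinearMap.adjoint_inner_right]
  exact (inner_conj_symm _ _).symm

theorem continuous_entry (x y : Site N) :
    Continuous fun A : Hdisc N →L[ℂ] Hdisc N => entry A x y := by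
  simp only [entry_eq_inner]
  fun_prop

/-- The algebra of the bounded operators whose kernel is invariant under lattice translations. -/
def periodicSubalgebra (N : ℕ) : StarSubalgebra ℂ (Hdisc N →L[ℂ] Hdisc N) where
  carrier := {A | ∀ p x y, entry A (translate p x) (translate p y) = entry A x y}
  mul_mem' {A B} hA hB p x y := by
    rw [entry_mul, entry_mul, ← (translate p).tsum_eq]
    exact tsum_congr fun u => by rw [hA, hB]
  add_mem' {A B} hA hB p x y := congrArg₂ (· + ·) (hA p x y) (hB p x y)
  algebraMap_mem' r p x y := by
    simp [entry, Algebra.algebraMap_eq_smul_one, delta_apply]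
  star_mem' {A} hA p x y := by rw [entry_star, entry_star, hA]

theorem isClosed_periodicSubalgebra :
    IsClosed (periodicSubalgebra N : Set (Hdisc N →L[ℂ] Hdisc N)) := by
  have : (periodicSubalgebra N : Set (Hdisc N →L[ℂ] Hdisc N)) =
      ⋂ (p) (x) (y), {A | entry A (translate p x) (translate p y) = entry A x y} := by
    ext A
    simp only [Set.mem_iInter]
    rfl
  rw [this]
  exact isClosed_iInter fun _ => isClosed_iInter fun _ => isClosed_iInter fun _ =>
    isClosed_eq (continuous_entry _ _) (continuous_entry _ _)

theorem IsPeriodic.mem_periodicSubalgebra {A : Hdisc N →L[ℂ] Hdisc N} (h : IsPeriodic A) :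
    A ∈ periodicSubalgebra N := by
  rintro p ⟨m, i⟩ ⟨n, k⟩
  have := congrFun (congrFun (h (m + p) (n + p) p) i) k
  rwa [kernel_ofBounded, kernel_ofBounded, add_sub_cancel_right, add_sub_cancel_right] at this

theorem IsPeriodic.fermi_mem_periodicSubalgebra {H : Hdisc N →L[ℂ] Hdisc N} (h : IsPeriodic H)
    (μ : ℝ) : fermi H μ ∈ periodicSubalgebra N :=
  have := isClosed_periodicSubalgebra (N := N)
  cfc_mem (S := StarSubalgebra ℂ (Hdisc N →L[ℂ] Hdisc N)) _ h.mem_periodicSubalgebra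

/-! ### The Fermi projection -/

/-- The properties of the Fermi projection on which the theorem rests: an orthogonal projection
with periodic kernel, all of whose moments are finite. -/
structure IsLocalProj (P : Hdisc N →L[ℂ] Hdisc N) : Prop extends IsStarProjection P where
  periodic : P ∈ periodicSubalgebra N
  colNorm_ne_top : ∀ k, colNorm (polyWeight k) (absEntry P) ≠ ∞

theorem colNorm_algebraMap_add_smul_ne_top {w : Lattice → ℝ≥0∞} (h0 : w 0 ≤ 1)
    {A : Hdisc N →L[ℂ] Hdisc N} (hA : colNorm w (absEntry A) ≠ ∞) (r s μ : ℝ) :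
    colNorm w (absEntry (algebraMap ℝ _ r + s • (A - algebraMap ℝ _ μ))) ≠ ∞ := by
  rw [sub_eq_add_neg, ← map_neg]
  refine ne_top_of_le_ne_top (ENNReal.add_ne_top.2 ⟨colNorm_algebraMap_ne_top h0 r, ?_⟩)
    (colNorm_add_le _ _)
  rw [colNorm_smul]
  exact ENNReal.mul_ne_top enorm_ne_top (ne_top_of_le_ne_top
    (ENNReal.add_ne_top.2 ⟨hA, colNorm_algebraMap_ne_top h0 _⟩) (colNorm_add_le _ _))

theorem norm_entry_aeval_minorityPoly_le {c : ℝ} (hc : 0 ≤ c) {A : Hdisc N →L[ℂ] Hdisc N}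
    (hA : colNorm (expWeight c) (absEntry A) ≠ ∞) (n : ℕ) (x y : Site N) :
    ‖entry (Polynomial.aeval A (minorityPoly n)) x y‖ ≤
      (1 + (colNorm (expWeight c) (absEntry A)).toReal) *
        (4 * (1 + (colNorm (expWeight c) (absEntry A)).toReal) ^ 2) ^ n *
          Real.exp (-c * ‖x.1 - y.1‖) := by
  set M := (colNorm (expWeight c) (absEntry A)).toReal with hM
  have hM0 : 0 ≤ M := ENNReal.toReal_nonneg
  refine norm_entry_le_of_colNorm_le (by positivity)
    ((colNorm_aeval_minorityPoly_le (expWeight_add_le hc) (expWeight_zero_le_one c) A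
      n).trans_eq ?_) x y
  rw [← ENNReal.ofReal_toReal hA, ← hM, ← ENNReal.ofReal_one, ← ENNReal.ofReal_add zero_le_one hM0,
    ← ENNReal.ofReal_pow (by positivity), ← ENNReal.ofReal_ofNat 4,
    ← ENNReal.ofReal_pow (by positivity), ← ENNReal.ofReal_mul (by positivity)]
  rw [mul_pow, ← pow_mul]
  congr 1
  ring

theorem exists_norm_entry_fermi_le {H : Hdisc N →L[ℂ] Hdisc N} (hH : IsSelfAdjoint H)
    (hns : IsNearSighted H) {μ : ℝ} (hμ : μ ∉ spectrum ℝ H) :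
    ∃ C c : ℝ, 0 < c ∧ ∀ x y, ‖entry (fermi H μ) x y‖ ≤ C * Real.exp (-c * ‖x.1 - y.1‖) := by
  obtain ⟨s, a, ha0, ha1, happrox⟩ := exists_norm_spectralProjBelow_sub_aeval_le hH hμ
  obtain ⟨_, c, hc, hdecay⟩ := hns.norm_entry_le
  have hZ := colNorm_algebraMap_add_smul_ne_top (expWeight_zero_le_one (c / 2))
    (colNorm_expWeight_half_ne_top hc hdecay) (1 / 2) s μ
  set Z := algebraMap ℝ (Hdisc N →L[ℂ] Hdisc N) (1 / 2) + s • (H - algebraMap ℝ _ μ)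
  set M := (colNorm (expWeight (c / 2)) (absEntry Z)).toReal
  have hM : 0 ≤ M := ENNReal.toReal_nonneg
  obtain ⟨C, c', hc', hexp⟩ := exists_exp_decay_of_forall_le (K := 1 + M)
    (F := 4 * (1 + M) ^ 2) (by positivity) ha0 ha1 (by nlinarith) (half_pos hc)
  refine ⟨C, c', hc', fun x y => hexp _ _ (norm_nonneg _) fun n => ?_⟩
  set Q := Polynomial.aeval Z (minorityPoly n)
  calc ‖entry (fermi H μ) x y‖
      = ‖entry (fermi H μ - Q) x y + entry Q x y‖ := by
        rw [entry, entry, entry, sub_apply, lp.coeFn_sub, Pi.sub_apply,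
          sub_add_cancel]
    _ ≤ ‖fermi H μ - Q‖ + ‖entry Q x y‖ :=
        (norm_add_le _ _).trans (add_le_add_left (norm_entry_le _ x y) _)
    _ ≤ _ := add_le_add (happrox n)
        (norm_entry_aeval_minorityPoly_le (half_pos hc).le hZ n x y)

theorem isLocalProj_fermi {H : Hdisc N →L[ℂ] Hdisc N} (hH : IsSelfAdjoint H)
    (hns : IsNearSighted H) (hper : IsPeriodic H) {μ : ℝ} (hμ : μ ∉ spectrum ℝ H) :
    IsLocalProj (fermi H μ) := by
  obtain ⟨C, c, hc, hdecay⟩ := exists_norm_entry_fermi_le hH hns hμ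
  exact ⟨isStarProjection_spectralProjBelow hμ, hper.fermi_mem_periodicSubalgebra μ,
    colNorm_polyWeight_ne_top hc hdecay⟩

namespace IsLocalProj

variable {P : Hdisc N →L[ℂ] Hdisc N}

theorem entry_symm (hP : IsLocalProj P) (x y : Site N) : entry P y x = star (entry P x y) := by
  rw [← entry_star, hP.isSelfAdjoint.star_eq]

theorem entry_translate (hP : IsLocalProj P) (p : Lattice) (x y : Site N) :
    entry P (translate p x) (translate p y) = entry P x y := hP.periodic p x y

end IsLocalProj

/-! ### Polynomial growth and rapid decay -/

section PolyGrowth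

open Asymptotics

variable {α β G G' : Type*} [SeminormedAddCommGroup G] [SeminormedAddCommGroup G'] {π : α → G}
  {π' : β → G'} {f g : α → ℝ}

/-- Polynomial growth of a function in terms of the lattice component `π x` of its argument; for
a function of a pair of sites, `π` is the pair of lattice components. -/
def HasPolyGrowth (π : α → G) (f : α → ℝ) : Prop :=
  ∃ k : ℕ, f =O[⊤] fun x => (1 + ‖π x‖) ^ k

namespace HasPolyGrowth

theorem of_affine {C : ℝ} (h : ∀ x, |f x| ≤ C * (1 + ‖π x‖)) : HasPolyGrowth π f :=
  ⟨1, isBigO_top.2 ⟨C, fun x => by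
    rw [pow_one, Real.norm_eq_abs, Real.norm_of_nonneg (by positivity)]
    exact h x⟩⟩

theorem of_bounded {C : ℝ} (h : ∀ x, |f x| ≤ C) : HasPolyGrowth π f :=
  ⟨0, isBigO_top.2 ⟨C, fun x => by simpa using h x⟩⟩

theorem const (c : ℝ) : HasPolyGrowth π fun _ => c := of_bounded fun _ => le_rfl

theorem mul (hf : HasPolyGrowth π f) (hg : HasPolyGrowth π g) :
    HasPolyGrowth π fun x => f x * g x := by
  obtain ⟨k, hf⟩ := hf
  obtain ⟨l, hg⟩ := hg
  exact ⟨k + l, by simpa only [pow_add] using hf.mul hg⟩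

theorem const_mul (c : ℝ) (hf : HasPolyGrowth π f) : HasPolyGrowth π fun x => c * f x :=
  (const c).mul hf

theorem sub (hf : HasPolyGrowth π f) (hg : HasPolyGrowth π g) :
    HasPolyGrowth π fun x => f x - g x := by
  obtain ⟨k, hf⟩ := hf
  obtain ⟨l, hg⟩ := hg
  have hle {i : ℕ} (hi : i ≤ max k l) :
      (fun x => (1 + ‖π x‖) ^ i) =O[⊤] fun x => (1 + ‖π x‖) ^ max k l :=
    .of_norm_le fun x => by
      rw [Real.norm_of_nonneg (by positivity)]
      exact pow_le_pow_right₀ (by simp) hi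
  exact ⟨max k l, (hf.trans (hle (le_max_left k l))).sub (hg.trans (hle (le_max_right k l)))⟩

theorem comp (hf : HasPolyGrowth π f) {φ : β → α} {C : ℝ}
    (h : ∀ y, 1 + ‖π (φ y)‖ ≤ C * (1 + ‖π' y‖)) : HasPolyGrowth π' fun y => f (φ y) := by
  obtain ⟨k, hf⟩ := hf
  have hφ : (fun y => 1 + ‖π (φ y)‖) =O[⊤] fun y => 1 + ‖π' y‖ :=
    isBigO_top.2 ⟨C, fun y => by
      rw [Real.norm_of_nonneg (by positivity), Real.norm_of_nonneg (by positivity)]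
      exact h y⟩
  exact ⟨k, (hf.comp_tendsto (k := φ) Filter.tendsto_top).trans (hφ.pow k)⟩

theorem exists_enorm_le (hf : HasPolyGrowth π f) :
    ∃ C : ℝ≥0∞, C ≠ ∞ ∧ ∃ k, ∀ x, ‖f x‖ₑ ≤ C * polyWeight k (π x) := by
  obtain ⟨k, hf⟩ := hf
  obtain ⟨C, hC⟩ := isBigO_top.1 hf
  refine ⟨ENNReal.ofReal C, ENNReal.ofReal_ne_top, k, fun x => ?_⟩
  rw [polyWeight_eq_ofReal, ← ENNReal.ofReal_mul' (by positivity), ← ofReal_norm]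
  refine ENNReal.ofReal_le_ofReal ((hC x).trans_eq ?_)
  rw [Real.norm_of_nonneg (by positivity)]

end HasPolyGrowth

end PolyGrowth

namespace HasPolyGrowth

variable {f g : Site N → ℝ}

theorem coord (j : Fin 2) : HasPolyGrowth Prod.fst fun x : Site N => (x.1 j : ℝ) :=
  of_affine (C := 1) fun x => by
    have h := norm_le_pi_norm x.1 j
    rw [Int.norm_eq_abs] at h
    linarith

theorem internal (s : Internal N → ℝ) : HasPolyGrowth Prod.fst fun x : Site N => s x.2 :=
  of_bounded fun x => Finset.single_le_sum (f := fun i => |s i|) (fun _ _ => abs_nonneg _)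
    (Finset.mem_univ x.2)

theorem comp_fst (hf : HasPolyGrowth Prod.fst f) :
    HasPolyGrowth (Prod.map Prod.fst Prod.fst) fun z : Site N × Site N => f z.1 :=
  hf.comp (C := 1) fun z => by
    rw [one_mul]
    exact add_le_add_right (norm_fst_le (z.1.1, z.2.1)) 1

theorem comp_snd (hf : HasPolyGrowth Prod.fst f) :
    HasPolyGrowth (Prod.map Prod.fst Prod.fst) fun z : Site N × Site N => f z.2 :=
  hf.comp (C := 1) fun z => by
    rw [one_mul]
    exact add_le_add_right (norm_snd_le (z.1.1, z.2.1)) 1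

end HasPolyGrowth

/-- Vectors all of whose polynomial moments are finite. -/
def IsRapidlyDecaying (φ : Hdisc N) : Prop := ∀ k, ∑' x, ‖φ x‖ₑ * polyWeight k x.1 ≠ ∞

theorem isRapidlyDecaying_delta (y : Site N) : IsRapidlyDecaying (delta y) := by
  intro k
  rw [tsum_eq_single y fun x hx => by simp [delta_apply, hx]]
  simp [delta_apply, polyWeight]

theorem IsLocalProj.isRapidlyDecaying_apply {P : Hdisc N →L[ℂ] Hdisc N} (hP : IsLocalProj P)
    {φ : Hdisc N} (hφ : IsRapidlyDecaying φ) : IsRapidlyDecaying (P φ) := by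
  intro k
  refine ne_top_of_le_ne_top (ENNReal.mul_ne_top (hP.colNorm_ne_top k) (hφ k)) ?_
  simpa only [sub_zero] using tsum_enorm_apply_mul_weight_le (polyWeight_add_le k) P φ 0

theorem enorm_complex_ofReal (r : ℝ) : ‖(r : ℂ)‖ₑ = ‖r‖ₑ := by
  rw [← ofReal_norm, ← ofReal_norm, Complex.norm_real]

theorem tsum_enorm_ofReal_mul_ne_top {f : Site N → ℝ} (hf : HasPolyGrowth Prod.fst f)
    {φ : Hdisc N} (hφ : IsRapidlyDecaying φ) (k : ℕ) :
    ∑' x, ‖(f x : ℂ) * φ x‖ₑ * polyWeight k x.1 ≠ ∞ := by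
  obtain ⟨C, hC, l, hf⟩ := hf.exists_enorm_le
  refine ne_top_of_le_ne_top (ENNReal.mul_ne_top hC (hφ (l + k))) ?_
  rw [← ENNReal.tsum_mul_left]
  refine ENNReal.tsum_le_tsum fun x => ?_
  calc ‖(f x : ℂ) * φ x‖ₑ * polyWeight k x.1
      = ‖f x‖ₑ * ‖φ x‖ₑ * polyWeight k x.1 := by rw [enorm_mul, enorm_complex_ofReal]
    _ ≤ C * polyWeight l x.1 * ‖φ x‖ₑ * polyWeight k x.1 := by gcongr; exact hf x
    _ = C * (‖φ x‖ₑ * polyWeight (l + k) x.1) := by simp only [polyWeight, pow_add]; ring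

theorem IsRapidlyDecaying.exists_mem_graph_mulOp {φ : Hdisc N} (hφ : IsRapidlyDecaying φ)
    {f : Site N → ℝ} (hf : HasPolyGrowth Prod.fst f) :
    ∃ ψ, IsRapidlyDecaying ψ ∧ (φ, ψ) ∈ (mulOp f).graph := by
  have hsum := tsum_enorm_ofReal_mul_ne_top hf hφ
  have hmem : Memℓp (fun x => (f x : ℂ) * φ x) 2 := by
    refine Memℓp.of_exponent_ge (q := 1) (memℓp_gen ?_) (by norm_num)
    simpa [polyWeight] using ENNReal.summable_toReal (hsum 0)
  exact ⟨⟨_, hmem⟩, hsum, mem_graph_mulOp.2 fun _ => rfl⟩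

/-! ### Path sums -/

/-- The sum `∑_{u,v} P(x,u) P(u,v) P(v,y) h(u,v)` over the paths from `y` to `x` in three steps. -/
def pathSum (P : Hdisc N →L[ℂ] Hdisc N) (h : Site N × Site N → ℝ) (x y : Site N) : ℂ :=
  ∑' z : Site N × Site N, entry P x z.1 * entry P z.1 z.2 * entry P z.2 y * h z

theorem pathSum_const_mul (P : Hdisc N →L[ℂ] Hdisc N) (c : ℝ) (h : Site N × Site N → ℝ)
    (x y : Site N) : pathSum P (fun z => c * h z) x y = c * pathSum P h x y := by
  rw [pathSum, pathSum, ← tsum_mul_left]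
  refine tsum_congr fun z => ?_
  push_cast
  ring

/-- The antisymmetrised product `f(u) g(v) - g(u) f(v)`; its path sums are the matrix entries of
`P [[P, f], [P, g]] P`. -/
def wedge (f g : Site N → ℝ) (z : Site N × Site N) : ℝ := f z.1 * g z.2 - g z.1 * f z.2

theorem HasPolyGrowth.wedge {f g : Site N → ℝ} (hf : HasPolyGrowth Prod.fst f)
    (hg : HasPolyGrowth Prod.fst g) :
    HasPolyGrowth (Prod.map Prod.fst Prod.fst) (wedge f g) :=
  (hf.comp_fst.mul hg.comp_snd).sub (hg.comp_fst.mul hf.comp_snd)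

theorem polyWeight_prod_le {G G' : Type*} [SeminormedAddCommGroup G] [SeminormedAddCommGroup G']
    (k : ℕ) (p : G × G') : polyWeight k p ≤ polyWeight k p.1 * polyWeight k p.2 := by
  rw [polyWeight_eq_ofReal, polyWeight_eq_ofReal, polyWeight_eq_ofReal,
    ← ENNReal.ofReal_mul (by positivity), ← mul_pow]
  refine ENNReal.ofReal_le_ofReal (pow_le_pow_left₀ (by positivity) ?_ k)
  rw [Prod.norm_def]
  have hprod := mul_nonneg (norm_nonneg p.1) (norm_nonneg p.2)
  rcases max_cases ‖p.1‖ ‖p.2‖ with ⟨h, -⟩ | ⟨h, -⟩ <;>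
    rw [h] <;> nlinarith [norm_nonneg p.1, norm_nonneg p.2]

namespace IsLocalProj

variable {P : Hdisc N →L[ℂ] Hdisc N} (hP : IsLocalProj P)

include hP

theorem tsum_enorm_entry_mul_polyWeight_ne_top (k : ℕ) (y : Site N) :
    ∑' u, ‖entry P u y‖ₑ * polyWeight k u.1 ≠ ∞ :=
  hP.isRapidlyDecaying_apply (isRapidlyDecaying_delta y) k

theorem tsum_enorm_entry_row_mul_polyWeight_ne_top (k : ℕ) (x : Site N) :
    ∑' u, ‖entry P x u‖ₑ * polyWeight k u.1 ≠ ∞ := by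
  have h : ∀ u, ‖entry P x u‖ₑ = ‖entry P u x‖ₑ := fun u => by
    rw [hP.entry_symm x u, ← ofReal_norm, ← ofReal_norm, norm_star]
  simpa only [h] using hP.tsum_enorm_entry_mul_polyWeight_ne_top k x

theorem tsum_enorm_path_ne_top {h : Site N × Site N → ℝ}
    (hh : HasPolyGrowth (Prod.map Prod.fst Prod.fst) h) (x y : Site N) :
    ∑' z : Site N × Site N, ‖entry P x z.1 * entry P z.1 z.2 * entry P z.2 y * h z‖ₑ ≠ ∞ := by
  obtain ⟨C, hC, k, hh⟩ := hh.exists_enorm_le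
  have hentry (u v : Site N) : ‖entry P u v‖ₑ ≤ ‖P‖ₑ := by
    simpa only [ofReal_norm] using ENNReal.ofReal_le_ofReal (norm_entry_le P u v)
  refine ne_top_of_le_ne_top (ENNReal.mul_ne_top (ENNReal.mul_ne_top enorm_ne_top hC)
    (ENNReal.mul_ne_top (hP.tsum_enorm_entry_row_mul_polyWeight_ne_top k x)
      (hP.tsum_enorm_entry_mul_polyWeight_ne_top k y))) (b := ‖P‖ₑ * C * _) ?_
  rw [← ENNReal.tsum_mul_right, ← ENNReal.tsum_mul_left, ENNReal.tsum_prod']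
  refine ENNReal.tsum_le_tsum fun u => ?_
  rw [← ENNReal.tsum_mul_left, ← ENNReal.tsum_mul_left]
  refine ENNReal.tsum_le_tsum fun v => ?_
  calc ‖entry P x u * entry P u v * entry P v y * h (u, v)‖ₑ
      = ‖entry P x u‖ₑ * ‖entry P u v‖ₑ * ‖entry P v y‖ₑ * ‖h (u, v)‖ₑ := by
        rw [enorm_mul, enorm_mul, enorm_mul, enorm_complex_ofReal]
    _ ≤ ‖entry P x u‖ₑ * ‖P‖ₑ * ‖entry P v y‖ₑ *
        (C * (polyWeight k u.1 * polyWeight k v.1)) := by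
        gcongr
        · exact hentry _ _
        · exact (hh (u, v)).trans (mul_le_mul_right (polyWeight_prod_le k _) C)
    _ = _ := by ring

theorem summable_path {h : Site N × Site N → ℝ}
    (hh : HasPolyGrowth (Prod.map Prod.fst Prod.fst) h) (x y : Site N) :
    Summable fun z : Site N × Site N =>
      entry P x z.1 * entry P z.1 z.2 * entry P z.2 y * (h z : ℂ) :=
  .of_norm (tsum_enorm_ne_top_iff_summable_norm.1 (hP.tsum_enorm_path_ne_top hh x y))

theorem pathSum_sub {h h' : Site N × Site N → ℝ}
    (hh : HasPolyGrowth (Prod.map Prod.fst Prod.fst) h)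
    (hh' : HasPolyGrowth (Prod.map Prod.fst Prod.fst) h') (x y : Site N) :
    pathSum P (fun z => h z - h' z) x y = pathSum P h x y - pathSum P h' x y := by
  rw [pathSum, pathSum, pathSum, ← (hP.summable_path hh x y).tsum_sub (hP.summable_path hh' x y)]
  refine tsum_congr fun z => ?_
  push_cast
  ring

theorem tsum_entry_mul_entry (x y : Site N) : ∑' u, entry P x u * entry P u y = entry P x y := by
  rw [← entry_mul, hP.isIdempotentElem.eq]

theorem pathSum_fst {f : Site N → ℝ} (hf : HasPolyGrowth Prod.fst f) (x y : Site N) :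
    pathSum P (fun z => f z.1) x y = ∑' u, entry P x u * f u * entry P u y := by
  rw [pathSum, (hP.summable_path hf.comp_fst x y).tsum_prod]
  refine tsum_congr fun u => ?_
  rw [← hP.tsum_entry_mul_entry u y, ← tsum_mul_left]
  exact tsum_congr fun v => by ring

theorem pathSum_snd {f : Site N → ℝ} (hf : HasPolyGrowth Prod.fst f) (x y : Site N) :
    pathSum P (fun z => f z.2) x y = ∑' v, entry P x v * f v * entry P v y := by
  have hs := (Equiv.prodComm (Site N) (Site N)).summable_iff.2 (hP.summable_path hf.comp_snd x y)
  rw [pathSum, ← (Equiv.prodComm (Site N) (Site N)).tsum_eq]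
  refine hs.tsum_prod.trans (tsum_congr fun v => ?_)
  rw [← hP.tsum_entry_mul_entry x v, ← tsum_mul_right, ← tsum_mul_right]
  exact tsum_congr fun u => by
    simp only [Function.comp_apply, Equiv.prodComm_apply, Prod.swap_prod_mk]; ring

theorem pathSum_translate (h : Site N × Site N → ℝ) (p : Lattice) (x y : Site N) :
    pathSum P h (translate p x) (translate p y) =
      pathSum P (fun z => h (translate p z.1, translate p z.2)) x y := by
  rw [pathSum, pathSum, ← ((translate p).prodCongr (translate p)).tsum_eq]
  refine tsum_congr fun z => ?_
  simp only [Equiv.prodCongr_apply, Prod.map_apply', hP.entry_translate]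

-- Both one-variable sums collapse to the same sum because `P` is idempotent.
theorem pathSum_wedge_sub_const {f g : Site N → ℝ} (hf : HasPolyGrowth Prod.fst f)
    (hg : HasPolyGrowth Prod.fst g) (c : ℝ) (x y : Site N) :
    pathSum P (wedge f fun v => g v - c) x y = pathSum P (wedge f g) x y := by
  have hwedge : wedge f (fun v => g v - c) = fun z => wedge f g z - c * (f z.1 - f z.2) := by
    funext z; simp only [wedge]; ring
  rw [hwedge, hP.pathSum_sub (hf.wedge hg) ((hf.comp_fst.sub hf.comp_snd).const_mul c),
    pathSum_const_mul, hP.pathSum_sub hf.comp_fst hf.comp_snd, hP.pathSum_fst hf,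
    hP.pathSum_snd hf, sub_self, mul_zero, sub_zero]

theorem apply_eq_pathSum {f g : Site N → ℝ} (hf : HasPolyGrowth Prod.fst f)
    (hg : HasPolyGrowth Prod.fst g) {y : Site N} {b c : Hdisc N}
    (hb : (P (delta y), b) ∈ (mulOp g).graph) (hc : (P b, c) ∈ (mulOp f).graph) (x : Site N) :
    P c x = pathSum P (fun z => f z.1 * g z.2) x y := by
  rw [mem_graph_mulOp] at hb hc
  rw [pathSum, (hP.summable_path (hf.comp_fst.mul hg.comp_snd) x y).tsum_prod, apply_eq_tsum]
  refine tsum_congr fun u => ?_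
  rw [hc, apply_eq_tsum, ← tsum_mul_left, ← tsum_mul_left]
  refine tsum_congr fun v => ?_
  rw [hb, ← entry]
  push_cast
  ring

theorem exists_mem_graph_kubo {f g : Site N → ℝ} (hf : HasPolyGrowth Prod.fst f)
    (hg : HasPolyGrowth Prod.fst g) (y : Site N) :
    ∃ ψ, (delta y, ψ) ∈ (kubo P (mulOp f) (mulOp g)).graph ∧
      ∀ x, ψ x = Complex.I * pathSum P (wedge f g) x y := by
  have hφ := hP.isRapidlyDecaying_apply (isRapidlyDecaying_delta y)
  obtain ⟨a, ha, hPa⟩ := hφ.exists_mem_graph_mulOp hf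
  obtain ⟨b, hb, hPb⟩ := hφ.exists_mem_graph_mulOp hg
  obtain ⟨apb, -, hapb⟩ := (hP.isRapidlyDecaying_apply hb).exists_mem_graph_mulOp hf
  obtain ⟨bpa, -, hbpa⟩ := (hP.isRapidlyDecaying_apply ha).exists_mem_graph_mulOp hg
  obtain ⟨ab, -, hab⟩ := hb.exists_mem_graph_mulOp hf
  have hba : (a, ab) ∈ (mulOp g).graph := by
    rw [mem_graph_mulOp] at hPa hPb hab ⊢
    intro x
    rw [hab, hPb, hPa]
    ring
  refine ⟨_, mem_graph_kubo hP.isIdempotentElem hPa hPb hapb hbpa hab hba, fun x => ?_⟩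
  rw [show wedge f g = fun z => f z.1 * g z.2 - g z.1 * f z.2 from rfl,
    hP.pathSum_sub (hf.comp_fst.mul hg.comp_snd) (hg.comp_fst.mul hf.comp_snd),
    ← hP.apply_eq_pathSum hf hg hPb hapb, ← hP.apply_eq_pathSum hg hf hPa hbpa]
  rfl

end IsLocalProj

/-! ### The trace per unit cell -/

/-- The trace per unit cell `∑_i ∑_{u,v} P(x,u) P(u,v) P(v,x) h_i(u,v)`, `x = (0, i)`; the weight
`h` may depend on the base point `x` of the closed path. -/
def cellTrace (P : Hdisc N →L[ℂ] Hdisc N) (h : Internal N → Site N × Site N → ℝ) : ℂ :=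
  ∑ i, pathSum P (h i) (0, i) (0, i)

/-- The cyclic relabelling of closed paths `x → u → v → x` of three steps, considered up to
translations: the path is normalised so that the lattice component of `x` vanishes, and only the
internal component of `x` is recorded. -/
def rotatePath (N : ℕ) : Internal N × Site N × Site N ≃ Internal N × Site N × Site N where
  toFun w := (w.2.1.2, (w.2.2.1 - w.2.1.1, w.2.2.2), (-w.2.1.1, w.1))
  invFun w := (w.2.2.2, (-w.2.2.1, w.1), (w.2.1.1 - w.2.2.1, w.2.1.2))
  left_inv w := by simp
  right_inv w := by simp

namespace IsLocalProj

variable {P : Hdisc N →L[ℂ] Hdisc N} (hP : IsLocalProj P)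

include hP

theorem summable_closedPath {h : Internal N → Site N × Site N → ℝ}
    (hh : ∀ i, HasPolyGrowth (Prod.map Prod.fst Prod.fst) (h i)) :
    Summable fun w : Internal N × Site N × Site N =>
      entry P (0, w.1) w.2.1 * entry P w.2.1 w.2.2 * entry P w.2.2 (0, w.1) * (h w.1 w.2 : ℂ) := by
  refine .of_norm (tsum_enorm_ne_top_iff_summable_norm.1 ?_)
  rw [ENNReal.tsum_prod', tsum_fintype]
  exact ENNReal.sum_ne_top.2 fun i _ => hP.tsum_enorm_path_ne_top (hh i) (0, i) (0, i)

theorem cellTrace_sub {h h' : Internal N → Site N × Site N → ℝ}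
    (hh : ∀ i, HasPolyGrowth (Prod.map Prod.fst Prod.fst) (h i))
    (hh' : ∀ i, HasPolyGrowth (Prod.map Prod.fst Prod.fst) (h' i)) :
    cellTrace P (fun i z => h i z - h' i z) = cellTrace P h - cellTrace P h' := by
  rw [cellTrace, cellTrace, cellTrace, ← Finset.sum_sub_distrib]
  exact Finset.sum_congr rfl fun i _ => hP.pathSum_sub (hh i) (hh' i) _ _

theorem cellTrace_rotate {g : Site N → Site N → Site N → ℝ}
    (hg : ∀ p x u v, g (translate p x) (translate p u) (translate p v) = g x u v)
    (hg0 : ∀ i, HasPolyGrowth (Prod.map Prod.fst Prod.fst) fun z : Site N × Site N =>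
      g (0, i) z.1 z.2) :
    cellTrace P (fun i z => g z.1 z.2 (0, i)) = cellTrace P fun i z => g (0, i) z.1 z.2 := by
  have hs := hP.summable_closedPath hg0
  have hrotate (w : Internal N × Site N × Site N) :
      entry P (0, (rotatePath N w).1) (rotatePath N w).2.1 *
        entry P (rotatePath N w).2.1 (rotatePath N w).2.2 *
        entry P (rotatePath N w).2.2 (0, (rotatePath N w).1) *
        (g (0, (rotatePath N w).1) (rotatePath N w).2.1 (rotatePath N w).2.2 : ℂ) =
      entry P (0, w.1) w.2.1 * entry P w.2.1 w.2.2 * entry P w.2.2 (0, w.1) *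
        (g w.2.1 w.2.2 (0, w.1) : ℂ) := by
    obtain ⟨i, ⟨n, j⟩, ⟨m, k⟩⟩ := w
    have hu : ((0, j) : Site N) = translate (-n) (n, j) := by ext <;> simp
    have hv : ((m - n, k) : Site N) = translate (-n) (m, k) := by ext <;> simp [sub_eq_add_neg]
    have hx : ((-n, i) : Site N) = translate (-n) (0, i) := by ext <;> simp
    simp only [rotatePath, Equiv.coe_fn_mk]
    rw [hu, hv, hx, hP.entry_translate, hP.entry_translate, hP.entry_translate, hg]
    ring
  have hs' := ((rotatePath N).summable_iff.2 hs).congr hrotate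
  calc cellTrace P (fun i z => g z.1 z.2 (0, i))
      = ∑' w : Internal N × Site N × Site N, entry P (0, w.1) w.2.1 * entry P w.2.1 w.2.2 *
          entry P w.2.2 (0, w.1) * (g w.2.1 w.2.2 (0, w.1) : ℂ) := by
        rw [hs'.tsum_prod, tsum_fintype]; rfl
    _ = ∑' w : Internal N × Site N × Site N, entry P (0, w.1) w.2.1 * entry P w.2.1 w.2.2 *
          entry P w.2.2 (0, w.1) * (g (0, w.1) w.2.1 w.2.2 : ℂ) := by
        rw [← tsum_congr hrotate]
        exact (rotatePath N).tsum_eq fun w => entry P (0, w.1) w.2.1 * entry P w.2.1 w.2.2 *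
          entry P w.2.2 (0, w.1) * (g (0, w.1) w.2.1 w.2.2 : ℂ)
    _ = cellTrace P fun i z => g (0, i) z.1 z.2 := by
        rw [hs.tsum_prod, tsum_fintype]; rfl

variable (s : Internal N → ℝ) (j : Fin 2)

theorem cellTrace_fst_mul_coord_snd :
    cellTrace P (fun _ z => s z.1.2 * (z.2.1 j : ℝ)) = 0 := by
  have hdiff := (HasPolyGrowth.coord (N := N) j).comp_fst.sub
    (HasPolyGrowth.coord (N := N) j).comp_snd
  calc cellTrace P (fun _ z => s z.1.2 * (z.2.1 j : ℝ))
      = cellTrace P (fun i z => s z.1.2 * ((z.2.1 j : ℝ) - ((0, i) : Site N).1 j)) := by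
        simp only [Pi.zero_apply, Int.cast_zero, sub_zero]
    _ = cellTrace P (fun i z => s i * ((z.1.1 j : ℝ) - z.2.1 j)) :=
        hP.cellTrace_rotate (g := fun x u v => s x.2 * ((u.1 j : ℝ) - v.1 j))
          (fun p x u v => by simp) fun i => hdiff.const_mul _
    _ = 0 := Finset.sum_eq_zero fun i _ => by
        rw [pathSum_const_mul, hP.pathSum_sub (HasPolyGrowth.coord j).comp_fst
          (HasPolyGrowth.coord j).comp_snd, hP.pathSum_fst (HasPolyGrowth.coord j),
          hP.pathSum_snd (HasPolyGrowth.coord j), sub_self, mul_zero]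

theorem cellTrace_coord_fst_mul_snd :
    cellTrace P (fun _ z => (z.1.1 j : ℝ) * s z.2.2) = 0 := by
  have hs := HasPolyGrowth.internal s
  have hmul := (hs.comp_fst.mul (HasPolyGrowth.coord j).comp_snd).const_mul (-1)
  calc cellTrace P (fun _ z => (z.1.1 j : ℝ) * s z.2.2)
      = cellTrace P (fun i z => ((z.1.1 j : ℝ) - ((0, i) : Site N).1 j) * s z.2.2) := by
        simp only [Pi.zero_apply, Int.cast_zero, sub_zero]
    _ = cellTrace P (fun i z => ((((0, i) : Site N).1 j : ℝ) - z.2.1 j) * s z.1.2) :=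
        hP.cellTrace_rotate (g := fun x u v => ((x.1 j : ℝ) - v.1 j) * s u.2)
          (fun p x u v => by simp)
          fun i => by simpa [mul_comm] using hmul
    _ = cellTrace P (fun _ z => -1 * (s z.1.2 * (z.2.1 j : ℝ))) := by
        congr! 3 with i z
        simp only [Pi.zero_apply, Int.cast_zero]
        ring
    _ = ((-1 : ℝ) : ℂ) * cellTrace P (fun _ z => s z.1.2 * (z.2.1 j : ℝ)) := by
        simp only [cellTrace, pathSum_const_mul, Finset.mul_sum]
    _ = 0 := by rw [hP.cellTrace_fst_mul_coord_snd s j, mul_zero]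

theorem cellTrace_wedge_coord :
    cellTrace P (fun _ => wedge (fun u => s u.2) fun v => (v.1 j : ℝ)) = 0 := by
  have hs := HasPolyGrowth.internal s
  have hcoord := HasPolyGrowth.coord (N := N) j
  rw [show (fun _ : Internal N => wedge (fun u => s u.2) fun v => (v.1 j : ℝ)) =
      fun _ z => s z.1.2 * (z.2.1 j : ℝ) - (z.1.1 j : ℝ) * s z.2.2 from rfl,
    hP.cellTrace_sub (fun _ => hs.comp_fst.mul hcoord.comp_snd)
      (fun _ => hcoord.comp_fst.mul hs.comp_snd),
    hP.cellTrace_fst_mul_coord_snd, hP.cellTrace_coord_fst_mul_snd s j, sub_self]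

end IsLocalProj

/-! ### Switch functions of one variable -/

/-- The profile of a switch function, as a function of one coordinate: it is bounded by `1` and its
(absolutely summable) increments add up to `1`. -/
structure IsStep (l : ℤ → ℝ) : Prop where
  abs_le_one : ∀ n, |l n| ≤ 1
  hasSum_sub : HasSum (fun n => l (1 + n) - l n) 1

-- Up to a finitely supported function, whose increments add up to `0`, the profile is the unit
-- step at `0`.
theorem hasSum_sub_of_eventually_const {l : ℤ → ℝ} {a b : ℤ} (h0 : ∀ n < a, l n = 0)
    (h1 : ∀ n, b ≤ n → l n = 1) : HasSum (fun n => l (1 + n) - l n) 1 := by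
  set θ : ℤ → ℝ := fun n => if 0 ≤ n then 1 else 0 with hθ
  have hd : Summable fun n => l n - θ n := by
    refine summable_of_ne_finset_zero (s := Finset.Ico (min a 0) (max b 0)) fun n hn => ?_
    rw [Finset.mem_Ico, not_and_or, not_le, not_lt, lt_min_iff, max_le_iff] at hn
    rcases hn with ⟨ha, hn⟩ | ⟨hb, hn⟩
    · simp [hθ, h0 n ha, hn.not_ge]
    · simp [hθ, h1 n hb, hn]
  have h := (((Equiv.addLeft 1).hasSum_iff.2 hd.hasSum).sub hd.hasSum).add
    (hasSum_ite_eq (-1 : ℤ) (1 : ℝ))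
  rw [sub_self, zero_add] at h
  refine h.congr_fun fun n => ?_
  have hθ1 : θ (1 + n) - θ n = if n = -1 then 1 else 0 := by
    simp only [hθ]
    split_ifs <;> first | omega | norm_num
  simp only [Function.comp_apply, Equiv.coe_addLeft, ← hθ1]
  ring

theorem IsSwitch.exists_isStep {j : Fin 2} {Λ : Lattice → ℝ} (h : IsSwitch j Λ) :
    ∃ l, IsStep l ∧ ∀ n, Λ n = l (n j) := by
  obtain ⟨h01, hdep, a, b, -, h0, h1⟩ := h
  refine ⟨fun n => Λ fun _ => n, ⟨fun n => ?_, hasSum_sub_of_eventually_const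
    (fun n hn => h0 (fun _ => n) hn) fun n hn => h1 (fun _ => n) hn⟩, fun n => hdep _ _ rfl⟩
  rw [abs_of_nonneg (h01 _).1]
  exact (h01 _).2

section Increments

variable (l : ℤ → ℝ)

theorem tsum_enorm_add_sub_le (v w : ℤ) : ∑' n, ‖l (v + w + n) - l n‖ₑ ≤
    ∑' n, ‖l (v + n) - l n‖ₑ + ∑' n, ‖l (w + n) - l n‖ₑ := by
  rw [← (Equiv.addLeft w).tsum_eq (fun n => ‖l (v + n) - l n‖ₑ), ← ENNReal.tsum_add]
  refine ENNReal.tsum_le_tsum fun n => ?_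
  rw [Equiv.coe_addLeft, ← add_assoc, ← sub_add_sub_cancel _ (l (w + n))]
  exact enorm_add_le _ _

theorem tsum_enorm_neg_sub (v : ℤ) :
    ∑' n, ‖l (-v + n) - l n‖ₑ = ∑' n, ‖l (v + n) - l n‖ₑ := by
  rw [← (Equiv.addLeft v).tsum_eq]
  simp only [Equiv.coe_addLeft, neg_add_cancel_left]
  exact tsum_congr fun n => enorm_sub_rev _ _

theorem tsum_enorm_shift_sub_le (v : ℤ) :
    ∑' n, ‖l (v + n) - l n‖ₑ ≤ ‖(v : ℝ)‖ₑ * ∑' n, ‖l (1 + n) - l n‖ₑ := by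
  have hnat (k : ℕ) : ∑' n, ‖l (k + n) - l n‖ₑ ≤ k * ∑' n, ‖l (1 + n) - l n‖ₑ := by
    induction k with
    | zero => simp
    | succ k ih =>
      push_cast
      rw [add_mul, one_mul]
      exact (tsum_enorm_add_sub_le l k 1).trans (add_le_add_left ih _)
  obtain ⟨k, rfl | rfl⟩ := v.eq_nat_or_neg
  · simpa using hnat k
  · simpa [tsum_enorm_neg_sub] using hnat k

end Increments

namespace IsStep

variable {l : ℤ → ℝ} (hl : IsStep l)

include hl

theorem abs_sub_le (m n : ℤ) : |l m - l n| ≤ 2 := by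
  linarith [abs_sub (l m) (l n), hl.abs_le_one m, hl.abs_le_one n]

theorem tsum_enorm_sub_ne_top : ∑' n, ‖l (1 + n) - l n‖ₑ ≠ ∞ :=
  tsum_enorm_ne_top_iff_summable_norm.2 hl.hasSum_sub.summable.norm

theorem hasSum_shift_sub (v : ℤ) : HasSum (fun n => l (v + n) - l n) (v : ℝ) := by
  induction v using Int.induction_on with
  | zero => simp
  | succ v ih =>
    have h := ((Equiv.addLeft (v : ℤ)).hasSum_iff.2 hl.hasSum_sub).add ih
    push_cast at h ⊢
    rw [add_comm (v : ℝ)]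
    refine h.congr_fun fun n => ?_
    rw [Function.comp_apply, Equiv.coe_addLeft, show 1 + ((v : ℤ) + n) = v + 1 + n by ring]
    ring
  | pred v ih =>
    have h := ih.sub ((Equiv.addLeft (-(v : ℤ) - 1)).hasSum_iff.2 hl.hasSum_sub)
    push_cast at h ⊢
    refine h.congr_fun fun n => ?_
    rw [Function.comp_apply, Equiv.coe_addLeft, show 1 + (-(v : ℤ) - 1 + n) = -v + n by ring]
    ring

theorem hasPolyGrowth_shift (j : Fin 2) (n : ℤ) :
    HasPolyGrowth Prod.fst fun x : Site N => l (x.1 j + n) :=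
  .of_bounded fun _ => hl.abs_le_one _

theorem hasPolyGrowth_shift_sub (j : Fin 2) (n : ℤ) :
    HasPolyGrowth Prod.fst fun x : Site N => l (x.1 j + n) - l n :=
  .of_bounded fun _ => hl.abs_sub_le _ _

end IsStep

/-! ### Sums over translates -/

theorem pathSum_wedge_swap (P : Hdisc N →L[ℂ] Hdisc N) (f g : Site N → ℝ) (x y : Site N) :
    pathSum P (wedge f g) x y = -pathSum P (wedge g f) x y := by
  rw [pathSum, pathSum, ← tsum_neg]
  refine tsum_congr fun z => ?_
  simp only [wedge]
  push_cast
  ring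

namespace IsLocalProj

variable {P : Hdisc N →L[ℂ] Hdisc N} (hP : IsLocalProj P)

include hP

theorem hasSum_pathSum {ι : Type*} {h : ι → Site N × Site N → ℝ} {h' : Site N × Site N → ℝ}
    (hh' : HasPolyGrowth (Prod.map Prod.fst Prod.fst) h') {K : ℝ≥0∞} (hK : K ≠ ∞)
    (hbound : ∀ z, ∑' i, ‖h i z‖ₑ ≤ ‖h' z‖ₑ * K) (hsum : ∀ z, HasSum (fun i => h i z) (h' z))
    (x y : Site N) : HasSum (fun i => pathSum P (h i) x y) (pathSum P h' x y) := by
  set F : (Site N × Site N) × ι → ℂ := fun q =>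
    entry P x q.1.1 * entry P q.1.1 q.1.2 * entry P q.1.2 y * (h q.2 q.1 : ℂ)
  have hs : Summable F := by
    refine .of_norm (tsum_enorm_ne_top_iff_summable_norm.1 ?_)
    refine ne_top_of_le_ne_top
      (ENNReal.mul_ne_top (hP.tsum_enorm_path_ne_top hh' x y) hK) ?_
    rw [ENNReal.tsum_prod', ← ENNReal.tsum_mul_right]
    refine ENNReal.tsum_le_tsum fun z => ?_
    simp only [F, enorm_mul, enorm_complex_ofReal, ENNReal.tsum_mul_left, mul_assoc]
    gcongr
    exact hbound z
  have hs' := (Equiv.prodComm _ _).summable_iff.2 hs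
  have htsum : ∑' q, F (Equiv.prodComm _ _ q) = pathSum P h' x y := by
    rw [(Equiv.prodComm _ _).tsum_eq F, hs.tsum_prod]
    refine tsum_congr fun z => ?_
    simp only [F, tsum_mul_left]
    rw [← Complex.ofReal_tsum, (hsum z).tsum_eq]
  exact htsum ▸ hs'.hasSum.prod_fiberwise fun i => (hs'.prod_factor i).hasSum

theorem hasSum_pathSum_shift_sub {l : ℤ → ℝ} (hl : IsStep l) {c : Site N × Site N → ℤ}
    {k : Site N × Site N → ℝ}
    (hck : HasPolyGrowth (Prod.map Prod.fst Prod.fst) fun z => (c z : ℝ) * k z) (x y : Site N) :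
    HasSum (fun n => pathSum P (fun z => (l (c z + n) - l n) * k z) x y)
      (pathSum P (fun z => c z * k z) x y) := by
  refine hP.hasSum_pathSum hck hl.tsum_enorm_sub_ne_top (fun z => ?_)
    (fun z => (hl.hasSum_shift_sub (c z)).mul_right (k z)) x y
  simp only [enorm_mul, ENNReal.tsum_mul_right]
  rw [mul_right_comm]
  gcongr
  exact tsum_enorm_shift_sub_le l (c z)

theorem hasSum_pathSum_wedge {l : ℤ → ℝ} (hl : IsStep l) (j : Fin 2) {f : Site N → ℝ}
    (hf : HasPolyGrowth Prod.fst f) (s : Internal N → ℝ) (x y : Site N) :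
    HasSum (fun n => pathSum P (wedge f fun v => (l (v.1 j + n) - l n) * s v.2) x y)
      (pathSum P (wedge f fun v => (v.1 j : ℝ) * s v.2) x y) := by
  have hs := HasPolyGrowth.internal s
  have hc := HasPolyGrowth.coord (N := N) j
  have hfs := hf.comp_fst.mul hs.comp_snd
  have hsf := hs.comp_fst.mul hf.comp_snd
  have h := (hP.hasSum_pathSum_shift_sub hl (c := fun z => z.2.1 j) (hc.comp_snd.mul hfs) x y).sub
    (hP.hasSum_pathSum_shift_sub hl (c := fun z => z.1.1 j) (hc.comp_fst.mul hsf) x y)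
  have hwedge (d : Site N → ℝ) : wedge f (fun v => d v * s v.2) =
      fun z => d z.2 * (f z.1 * s z.2.2) - d z.1 * (s z.1.2 * f z.2) := by
    funext z
    simp only [wedge]
    ring
  rw [hwedge, hP.pathSum_sub (hc.comp_snd.mul hfs) (hc.comp_fst.mul hsf)]
  refine h.congr_fun fun n => ?_
  rw [hwedge, hP.pathSum_sub ((hl.hasPolyGrowth_shift_sub j n).comp_snd.mul hfs)
    ((hl.hasPolyGrowth_shift_sub j n).comp_fst.mul hsf)]

end IsLocalProj

/-! ### Bounded double commutators and their traces on stripes -/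

/-- The bounded operator `i P [[P, A], [P, B]] P`, for a projection `P` and bounded `A`, `B` that
commute. -/
def kuboBounded (P A B : Hdisc N →L[ℂ] Hdisc N) : Hdisc N →L[ℂ] Hdisc N :=
  Complex.I • (P * A * P * B * P - P * B * P * A * P)

/-- The kernel of absolute values of the paths of two steps, which dominates that of `P = P²`. -/
def twoStep (P : Hdisc N →L[ℂ] Hdisc N) (u y : Site N) : ℝ≥0∞ :=
  ∑' w, absEntry P u w * absEntry P w y

theorem enorm_apply_boundedMul_apply_delta_le (P : Hdisc N →L[ℂ] Hdisc N) {f : Site N → ℝ} {C : ℝ}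
    (hf : ∀ x, |f x| ≤ C) (u y : Site N) :
    ‖P (boundedMul f hf (P (delta y))) u‖ₑ ≤ ‖C‖ₑ * twoStep P u y := by
  refine (enorm_apply_le P _ u).trans ?_
  rw [twoStep, ← ENNReal.tsum_mul_left]
  refine ENNReal.tsum_le_tsum fun w => ?_
  rw [boundedMul_apply, enorm_mul, enorm_complex_ofReal, mul_left_comm ‖C‖ₑ]
  gcongr
  · exact enorm_le_iff_norm_le.2 ((hf w).trans (le_abs_self C))
  · exact le_rfl

theorem enorm_boundedMul_sub_smul_le {g : Site N → ℝ} {C : ℝ} (hg : ∀ x, |g x| ≤ C) (c : ℝ)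
    (φ : Hdisc N) : ‖boundedMul g hg φ - (c : ℂ) • φ‖ₑ ≤ ∑' u, ‖g u - c‖ₑ * ‖φ u‖ₑ := by
  refine (enorm_le_tsum_enorm _).trans_eq (tsum_congr fun u => ?_)
  rw [← enorm_complex_ofReal, ← enorm_mul, Complex.ofReal_sub, sub_mul]
  rfl

theorem tsum_lattice_mul (F G : ℤ → ℝ≥0∞) :
    ∑' n : Lattice, F (n 0) * G (n 1) = (∑' n, F n) * ∑' n, G n := by
  rw [← (finTwoArrowEquiv ℤ).symm.tsum_eq, ENNReal.tsum_prod']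
  simp [ENNReal.tsum_mul_left, ENNReal.tsum_mul_right]

theorem tsum_mul_enorm_shift_sub_le (χ : ℤ → ℝ≥0∞) (l : ℤ → ℝ) (v : Lattice) :
    ∑' n : Lattice, χ (n 0) * ‖l (v 1 + n 1) - l (n 1)‖ₑ ≤
      (∑' n, χ n) * (∑' n, ‖l (1 + n) - l n‖ₑ) * polyWeight 1 v := by
  have hv : ‖(v 1 : ℝ)‖ₑ ≤ polyWeight 1 v := by
    rw [polyWeight, pow_one, ← ofReal_norm, ← ofReal_norm, Int.norm_cast_real]
    exact (ENNReal.ofReal_le_ofReal (norm_le_pi_norm v 1)).trans le_add_self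
  rw [tsum_lattice_mul χ fun n => ‖l (v 1 + n) - l n‖ₑ, mul_assoc]
  gcongr
  refine (tsum_enorm_shift_sub_le l (v 1)).trans ?_
  rw [mul_comm]
  gcongr

theorem tsum_stripe_le {r : Site N → Site N → ℝ≥0∞}
    (hr : ∀ p x y, r (translate p x) (translate p y) = r x y) (χ : ℤ → ℝ≥0∞) (l : ℤ → ℝ) :
    ∑' y : Site N, χ (y.1 0) * ∑' u : Site N, ‖l (u.1 1) - l (y.1 1)‖ₑ * r u y ≤
      ∑ _ : Internal N,
        (∑' n, χ n) * (∑' n, ‖l (1 + n) - l n‖ₑ) * colNorm (polyWeight 1) r := by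
  rw [← (Equiv.prodComm (Internal N) Lattice).tsum_eq, ENNReal.tsum_prod', tsum_fintype]
  refine Finset.sum_le_sum fun i _ => ?_
  have htranslate (n : Lattice) : χ (n 0) * ∑' u : Site N, ‖l (u.1 1) - l (n 1)‖ₑ * r u (n, i) =
      ∑' u : Site N, χ (n 0) * ‖l (u.1 1 + n 1) - l (n 1)‖ₑ * r u (0, i) := by
    rw [← (translate n).tsum_eq, ← ENNReal.tsum_mul_left]
    refine tsum_congr fun u => ?_
    rw [← hr n u (0, i), mul_assoc, translate_zero_mk]
    rfl
  calc ∑' n : Lattice, χ (n 0) * ∑' u : Site N, ‖l (u.1 1) - l (n 1)‖ₑ * r u (n, i)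
      = ∑' u : Site N, (∑' n : Lattice, χ (n 0) * ‖l (u.1 1 + n 1) - l (n 1)‖ₑ) * r u (0, i) := by
        simp only [htranslate, ← ENNReal.tsum_mul_right]
        exact ENNReal.tsum_comm
    _ ≤ ∑' u : Site N, (∑' n, χ n) * (∑' n, ‖l (1 + n) - l n‖ₑ) * polyWeight 1 u.1 *
          r u (0, i) :=
        ENNReal.tsum_le_tsum fun u => mul_le_mul_left (tsum_mul_enorm_shift_sub_le χ l u.1) _
    _ = (∑' n, χ n) * (∑' n, ‖l (1 + n) - l n‖ₑ) *
          ∑' u : Site N, r u (0, i) * polyWeight 1 (u.1 - 0) := by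
        simp only [sub_zero, mul_comm (r _ _), mul_assoc, ENNReal.tsum_mul_left]
    _ ≤ _ := by
        gcongr
        exact tsum_le_colNorm r (0, i)

namespace IsLocalProj

variable {P : Hdisc N →L[ℂ] Hdisc N} (hP : IsLocalProj P)

include hP

theorem absEntry_le_twoStep (u y : Site N) : absEntry P u y ≤ twoStep P u y := by
  have h := enorm_apply_le P (P (delta y)) u
  rwa [show P (P (delta y)) = P (delta y) from DFunLike.congr_fun hP.isIdempotentElem.eq _] at h

theorem twoStep_translate (p : Lattice) (x y : Site N) :
    twoStep P (translate p x) (translate p y) = twoStep P x y := by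
  rw [twoStep, ← (translate p).tsum_eq]
  simp only [absEntry, hP.entry_translate, twoStep]

theorem colNorm_twoStep_ne_top (k : ℕ) : colNorm (polyWeight k) (twoStep P) ≠ ∞ := by
  refine ne_top_of_le_ne_top
    (ENNReal.mul_ne_top (hP.colNorm_ne_top k) (hP.colNorm_ne_top k)) (iSup_le fun y => ?_)
  refine (tsum_tsum_mul_weight_le (polyWeight_add_le k) (absEntry P)
    (fun w => absEntry P w y) y.1).trans ?_
  gcongr
  exact tsum_le_colNorm (absEntry P) y

section BoundedFunctions

variable {f g : Site N → ℝ} {C C' : ℝ} (hf : ∀ x, |f x| ≤ C) (hg : ∀ x, |g x| ≤ C')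

theorem mem_graph_kuboBounded (φ : Hdisc N) :
    (φ, kuboBounded P (boundedMul f hf) (boundedMul g hg) φ) ∈
      (kubo P (mulOp f) (mulOp g)).graph :=
  mem_graph_kubo hP.isIdempotentElem (mem_graph_boundedMul hf _) (mem_graph_boundedMul hg _)
    (mem_graph_boundedMul hf _) (mem_graph_boundedMul hg _) (mem_graph_boundedMul hf _)
    (mem_graph_mulOp.2 fun x => by simp only [boundedMul_apply]; ring)

theorem entry_kuboBounded (x y : Site N) :
    entry (kuboBounded P (boundedMul f hf) (boundedMul g hg)) x y =
      Complex.I * pathSum P (wedge f g) x y := by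
  obtain ⟨ψ, hψ, hψx⟩ := hP.exists_mem_graph_kubo (.of_bounded hf) (.of_bounded hg) y
  rw [← hψx x, entry,
    LinearPMap.mem_graph_snd_inj _ (hP.mem_graph_kuboBounded hf hg _) hψ rfl]

-- Additive constants in `g` drop out of the double commutator, so that `g` may be replaced by
-- `g - g y` on the column of `y`.
theorem enorm_kuboBounded_delta_le (y : Site N) :
    ‖kuboBounded P (boundedMul f hf) (boundedMul g hg) (delta y)‖ₑ ≤
      (‖P * boundedMul f hf * P‖ₑ + ‖P‖ₑ * ‖C‖ₑ) *
        ∑' u, ‖g u - g y‖ₑ * twoStep P u y := by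
  have hPP (ψ : Hdisc N) : P (P ψ) = P ψ := DFunLike.congr_fun hP.isIdempotentElem.eq ψ
  set A := boundedMul f hf
  set B := boundedMul g hg
  set c : ℂ := ((g y : ℝ) : ℂ)
  set φ := P (delta y) with hφ
  have hsub : kuboBounded P A B (delta y) =
      Complex.I • ((P * A * P) (B φ - c • φ) - P (B (P (A φ)) - c • P (A φ))) := by
    simp only [kuboBounded, _root_.smul_apply, _root_.sub_apply, mul_apply_eq_comp, map_sub,
      map_smul, hPP, ← hφ, show P φ = φ from hPP _, sub_sub_sub_cancel_right]
  have hleft : ‖B φ - c • φ‖ₑ ≤ ∑' u, ‖g u - g y‖ₑ * twoStep P u y :=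
    (enorm_boundedMul_sub_smul_le hg (g y) φ).trans <|
      ENNReal.tsum_le_tsum fun u => mul_le_mul_right (hP.absEntry_le_twoStep u y) _
  have hright : ‖B (P (A φ)) - c • P (A φ)‖ₑ ≤ ‖C‖ₑ * ∑' u, ‖g u - g y‖ₑ * twoStep P u y := by
    refine (enorm_boundedMul_sub_smul_le hg (g y) _).trans ?_
    rw [← ENNReal.tsum_mul_left]
    refine ENNReal.tsum_le_tsum fun u => ?_
    rw [mul_left_comm]
    gcongr
    exact enorm_apply_boundedMul_apply_delta_le P hf u y
  rw [hsub, enorm_smul, show ‖Complex.I‖ₑ = 1 by rw [← ofReal_norm]; simp, one_mul, add_mul,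
    mul_assoc ‖P‖ₑ]
  refine enorm_sub_le.trans (add_le_add ?_ ?_)
  · exact ((P * A * P).le_opENorm _).trans (mul_le_mul_right hleft _)
  · exact (P.le_opENorm _).trans (mul_le_mul_right hright _)

theorem summable_stripe {l : ℤ → ℝ} (hl : IsStep l) (s : Finset ℤ) :
    Summable ({x : Site N | x.1 0 ∈ s}.indicator fun y =>
      ‖kuboBounded P (boundedMul f hf)
        (boundedMul (fun x => l (x.1 1)) fun x => hl.abs_le_one (x.1 1)) (delta y)‖) := by
  set χ : ℤ → ℝ≥0∞ := (s : Set ℤ).indicator 1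
  set T := ‖P * boundedMul f hf * P‖ₑ + ‖P‖ₑ * ‖C‖ₑ
  have hχ : ∑' n, χ n ≠ ∞ := by
    rw [tsum_eq_sum (s := s) fun n hn => by simp [χ, hn]]
    exact ENNReal.sum_ne_top.2 fun n hn => by simp [χ, hn]
  have hstripe : ∑' y : Site N, χ (y.1 0) *
      ∑' u : Site N, ‖l (u.1 1) - l (y.1 1)‖ₑ * twoStep P u y ≠ ∞ :=
    ne_top_of_le_ne_top (ENNReal.sum_ne_top.2 fun _ _ => ENNReal.mul_ne_top
      (ENNReal.mul_ne_top hχ hl.tsum_enorm_sub_ne_top) (hP.colNorm_twoStep_ne_top 1))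
      (tsum_stripe_le hP.twoStep_translate χ l)
  have hT : T ≠ ∞ := by simp [T, ENNReal.mul_eq_top]
  refine .of_norm (tsum_enorm_ne_top_iff_summable_norm.1
    (ne_top_of_le_ne_top (ENNReal.mul_ne_top hT hstripe) ?_))
  rw [← ENNReal.tsum_mul_left]
  refine ENNReal.tsum_le_tsum fun y => ?_
  by_cases hy : y.1 0 ∈ s
  · simpa [χ, hy] using
      hP.enorm_kuboBounded_delta_le hf (g := fun x => l (x.1 1)) (fun x => hl.abs_le_one _) y
  · simp [hy]

end BoundedFunctions

end IsLocalProj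

/-! ### Traces over squares and stripes -/

theorem abs_le_half_iff (k : ℕ) (n : ℤ) :
    |(n : ℝ)| ≤ ((2 * k + 1 : ℕ) : ℝ) / 2 ↔ n ∈ Finset.Icc (-(k : ℤ)) k := by
  have h : |(n : ℝ)| * 2 ≤ ((2 * k + 1 : ℕ) : ℝ) ↔ |n| * 2 ≤ 2 * (k : ℤ) + 1 := by
    rw [← Int.cast_abs]
    exact_mod_cast Iff.rfl
  rw [Finset.mem_Icc, ← abs_le, le_div_iff₀ two_pos, h]
  omega

/-- The sites over the square `[-k, k]²` of the lattice. -/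
def box (N k : ℕ) : Finset (Site N) :=
  (Fintype.piFinset fun _ => Finset.Icc (-(k : ℤ)) k) ×ˢ Finset.univ

theorem chi_eq (N k : ℕ) : chi N (2 * k + 1) = mulOp ((box N k : Set (Site N)).indicator 1) := by
  rw [chi, latOp]
  congr 1
  funext x
  simp only [Set.indicator_apply, Set.mem_ofPred_eq, Finset.mem_coe, box, Finset.mem_product,
    Finset.mem_univ, and_true, Fintype.mem_piFinset, abs_le_half_iff, Pi.one_apply]

theorem chiDir_eq (N : ℕ) (j : Fin 2) (k : ℕ) : chiDir N j (2 * k + 1) =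
    mulOp ({x : Site N | x.1 j ∈ Finset.Icc (-(k : ℤ)) k}.indicator 1) := by
  rw [chiDir, latOp]
  congr 1
  funext x
  simp only [Set.indicator_apply, Set.mem_ofPred_eq, abs_le_half_iff, Pi.one_apply]

theorem tsum_indicator_stripe (s : Finset ℤ) {F : Site N → ℂ}
    (h : Summable ({x : Site N | x.1 0 ∈ s}.indicator F)) :
    ∑' x, {x : Site N | x.1 0 ∈ s}.indicator F x = ∑ m ∈ s, ∑' n, ∑ i, F (![m, n], i) := by
  have hsum (n : Lattice) : ∑' i, {x : Site N | x.1 0 ∈ s}.indicator F (n, i) =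
      (s : Set ℤ).indicator (fun _ => ∑ i, F (n, i)) (n 0) := by
    by_cases hn : n 0 ∈ s <;> simp [hn, tsum_fintype]
  have hprod := (finTwoArrowEquiv ℤ).symm.summable_iff.2 h.prod
  rw [h.tsum_prod, ← (finTwoArrowEquiv ℤ).symm.tsum_eq]
  simp only [hsum, Function.comp_def] at hprod ⊢
  rw [hprod.tsum_prod, tsum_eq_sum (s := s) fun m hm => by simp [hm]]
  exact Finset.sum_congr rfl fun m hm => by simp [hm]

/-- The trace per unit cell of `i P [[P, X₁ s], [P, X₂]] P`, for an observable `s` of the internal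
degrees of freedom. -/
def cellConductivity (P : Hdisc N →L[ℂ] Hdisc N) (s : Internal N → ℝ) : ℂ :=
  Complex.I * cellTrace P fun _ => wedge (fun x => (x.1 0 : ℝ) * s x.2) fun x => (x.1 1 : ℝ)

namespace IsLocalProj

variable {P : Hdisc N →L[ℂ] Hdisc N} (hP : IsLocalProj P)

include hP

theorem mem_domain_kubo {f g : Site N → ℝ} (hf : HasPolyGrowth Prod.fst f)
    (hg : HasPolyGrowth Prod.fst g) (y : Site N) :
    delta y ∈ (kubo P (mulOp f) (mulOp g)).domain :=
  have ⟨_, hψ, _⟩ := hP.exists_mem_graph_kubo hf hg y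
  LinearPMap.mem_domain_of_mem_graph hψ

theorem kernel_kubo {f g : Site N → ℝ} (hf : HasPolyGrowth Prod.fst f)
    (hg : HasPolyGrowth Prod.fst g) (m n : Lattice) (i k : Internal N) :
    kernel (kubo P (mulOp f) (mulOp g)) m n i k =
      Complex.I * pathSum P (wedge f g) (m, i) (n, k) := by
  obtain ⟨ψ, hψ, hψx⟩ := hP.exists_mem_graph_kubo hf hg (n, k)
  rw [kernel_apply_of_mem_graph hψ, hψx]

variable (s : Internal N → ℝ)

theorem pathSum_wedge_sub_mul {f g : Site N → ℝ} (hf : HasPolyGrowth Prod.fst f)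
    (hg : HasPolyGrowth Prod.fst g) (c : ℝ) (x y : Site N) :
    pathSum P (wedge (fun u => (f u - c) * s u.2) g) x y =
      pathSum P (wedge (fun u => f u * s u.2) g) x y -
        c * pathSum P (wedge (fun u => s u.2) g) x y := by
  have hs := HasPolyGrowth.internal s
  have hwedge : wedge (fun u => (f u - c) * s u.2) g =
      fun z => wedge (fun u => f u * s u.2) g z - c * wedge (fun u => s u.2) g z := by
    funext z; simp only [wedge]; ring
  rw [hwedge, hP.pathSum_sub ((hf.mul hs).wedge hg) ((hs.wedge hg).const_mul _),
    pathSum_const_mul]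

theorem cellTrace_wedge_sub_const_mul {f : Site N → ℝ} (hf : HasPolyGrowth Prod.fst f) (c : ℝ)
    (j : Fin 2) :
    cellTrace P (fun _ => wedge (fun u => (f u - c) * s u.2) fun v => (v.1 j : ℝ)) =
      cellTrace P fun _ => wedge (fun u => f u * s u.2) fun v => (v.1 j : ℝ) := by
  have htorque := hP.cellTrace_wedge_coord s j
  simp only [cellTrace] at htorque
  simp only [cellTrace, hP.pathSum_wedge_sub_mul s hf (.coord j)]
  rw [Finset.sum_sub_distrib, ← Finset.mul_sum, htorque, mul_zero, sub_zero]

theorem pathSum_wedge_coord_translate (j j' : Fin 2) (p : Lattice) (x y : Site N) :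
    pathSum P (wedge (fun u => (u.1 j : ℝ) * s u.2) fun u => (u.1 j' : ℝ))
        (translate p x) (translate p y) =
      pathSum P (wedge (fun u => (u.1 j : ℝ) * s u.2) fun u => (u.1 j' : ℝ)) x y +
        (p j : ℂ) * pathSum P (wedge (fun u => s u.2) fun u => (u.1 j' : ℝ)) x y := by
  have hcoord (j : Fin 2) := HasPolyGrowth.coord (N := N) j
  have hf := ((hcoord j).sub (.const (-(p j : ℝ)))).mul (.internal s)
  have hwedge : (fun z : Site N × Site N => wedge (fun u => (u.1 j : ℝ) * s u.2)
      (fun u => (u.1 j' : ℝ)) (translate p z.1, translate p z.2)) =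
      wedge (fun u => ((u.1 j : ℝ) - -(p j : ℝ)) * s u.2)
        fun u => (u.1 j' : ℝ) - -(p j' : ℝ) := by
    funext z
    simp only [wedge, translate_fst, translate_snd, Pi.add_apply]
    push_cast
    ring
  rw [hP.pathSum_translate, hwedge, hP.pathSum_wedge_sub_const hf (hcoord j'),
    hP.pathSum_wedge_sub_mul s (hcoord j) (hcoord j')]
  push_cast
  ring

theorem sum_pathSum_wedge_coord (j j' : Fin 2) (n : Lattice) :
    ∑ i, pathSum P (wedge (fun u => (u.1 j : ℝ) * s u.2) fun u => (u.1 j' : ℝ)) (n, i) (n, i) =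
      cellTrace P fun _ => wedge (fun u => (u.1 j : ℝ) * s u.2) fun u => (u.1 j' : ℝ) := by
  have htorque := hP.cellTrace_wedge_coord s j'
  rw [cellTrace] at htorque
  simp only [← translate_zero_mk n, hP.pathSum_wedge_coord_translate s]
  rw [Finset.sum_add_distrib, ← Finset.mul_sum, htorque, mul_zero, add_zero, cellTrace]

theorem hasTrace_box (k : ℕ) :
    HasTrace (prod (chi N (2 * k + 1)) (prod
      (kubo P (mulOp fun x => (x.1 0 : ℝ) * s x.2) (mulOp fun x => (x.1 1 : ℝ)))
      (chi N (2 * k + 1)))) (((2 * k + 1 : ℕ) : ℂ) ^ 2 * cellConductivity P s) := by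
  choose V hV hVx using hP.exists_mem_graph_kubo
    ((HasPolyGrowth.coord (N := N) 0).mul (.internal s)) (.coord 1)
  have hcard : (Finset.Icc (-(k : ℤ)) k).card = 2 * k + 1 := by
    rw [Int.card_Icc]
    omega
  rw [chi_eq]
  convert hasTrace_compression_of_finite (box N k) fun y _ => hV y using 1
  simp only [hVx, box, Finset.sum_product, ← Finset.mul_sum, hP.sum_pathSum_wedge_coord s,
    Finset.sum_const, Fintype.card_piFinset_const, hcard, nsmul_eq_mul, Nat.cast_pow,
    cellConductivity, mul_left_comm]

theorem hasTUV :
    HasTUV (kubo P (mulOp fun x => (x.1 0 : ℝ) * s x.2) (mulOp fun x => (x.1 1 : ℝ)))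
      (cellConductivity P s) := by
  refine ⟨_, hP.hasTrace_box s, tendsto_const_nhds.congr fun k => ?_⟩
  have hk : ((2 * k + 1 : ℕ) : ℂ) ≠ 0 := Nat.cast_ne_zero.2 (by omega)
  field_simp

section Steps

variable {l l' : ℤ → ℝ} (hl : IsStep l) (hl' : IsStep l')

include hl

theorem hasSum_cellTrace_wedge_snd {f : Site N → ℝ} (hf : HasPolyGrowth Prod.fst f) (j : Fin 2) :
    HasSum (fun n => cellTrace P fun _ => wedge f fun v => l (v.1 j + n) - l n)
      (cellTrace P fun _ => wedge f fun v => (v.1 j : ℝ)) := by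
  refine hasSum_sum fun i _ => ?_
  simpa only [mul_one] using hP.hasSum_pathSum_wedge hl j hf (fun _ => 1) (0, i) (0, i)

theorem hasSum_cellTrace_wedge_fst {g : Site N → ℝ} (hg : HasPolyGrowth Prod.fst g) (j : Fin 2) :
    HasSum (fun n => cellTrace P fun _ => wedge (fun v => (l (v.1 j + n) - l n) * s v.2) g)
      (cellTrace P fun _ => wedge (fun v => (v.1 j : ℝ) * s v.2) g) := by
  refine hasSum_sum fun i _ => ?_
  simpa only [← pathSum_wedge_swap] using (hP.hasSum_pathSum_wedge hl j hg s (0, i) (0, i)).neg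

include hl'

theorem sum_pathSum_wedge_step (n : Lattice) :
    ∑ i, pathSum P (wedge (fun x => l (x.1 0) * s x.2) fun x => l' (x.1 1)) (n, i) (n, i) =
      cellTrace P fun _ => wedge (fun x => l (x.1 0 + n 0) * s x.2)
        fun x => l' (x.1 1 + n 1) - l' (n 1) := by
  simp only [← translate_zero_mk n, hP.pathSum_translate]
  exact Finset.sum_congr rfl fun i _ => (hP.pathSum_wedge_sub_const
    ((hl.hasPolyGrowth_shift 0 (n 0)).mul (.internal s)) (hl'.hasPolyGrowth_shift 1 (n 1))
    (l' (n 1)) _ _).symm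

theorem tsum_sum_pathSum_wedge_step (m : ℤ) :
    ∑' n, ∑ i, pathSum P (wedge (fun x => l (x.1 0) * s x.2) fun x => l' (x.1 1))
        (![m, n], i) (![m, n], i) =
      cellTrace P fun _ => wedge (fun x => (l (x.1 0 + m) - l m) * s x.2)
        fun x => (x.1 1 : ℝ) := by
  have hf := hl.hasPolyGrowth_shift (N := N) 0 m
  rw [hP.cellTrace_wedge_sub_const_mul s hf,
    ← (hP.hasSum_cellTrace_wedge_snd hl' (hf.mul (.internal s)) 1).tsum_eq]
  simp only [hP.sum_pathSum_wedge_step s hl hl', Matrix.cons_val_zero, Matrix.cons_val_one]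

theorem hasTrace_stripe (k : ℕ) :
    HasTrace (prod (chiDir N 0 (2 * k + 1)) (prod
      (kubo P (mulOp fun x => l (x.1 0) * s x.2) (mulOp fun x => l' (x.1 1)))
      (chiDir N 0 (2 * k + 1))))
      (∑ m ∈ Finset.Icc (-(k : ℤ)) k, Complex.I * cellTrace P fun _ =>
        wedge (fun x => (l (x.1 0 + m) - l m) * s x.2) fun x => (x.1 1 : ℝ)) := by
  obtain ⟨C, hC⟩ := Finite.exists_le fun i => |s i|
  have hf (x : Site N) : |l (x.1 0) * s x.2| ≤ C := by
    rw [abs_mul]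
    exact (mul_le_of_le_one_left (abs_nonneg _) (hl.abs_le_one _)).trans (hC x.2)
  have hg (x : Site N) : |l' (x.1 1)| ≤ 1 := hl'.abs_le_one _
  have hsum := hP.summable_stripe hf hl' (Finset.Icc (-(k : ℤ)) k)
  rw [chiDir_eq]
  convert hasTrace_compression_of_bounded (hP.mem_graph_kuboBounded hf hg) hsum using 1
  rw [tsum_indicator_stripe _ (.of_norm_bounded hsum fun x => ?_)]
  · simp only [hP.entry_kuboBounded, ← Finset.mul_sum, tsum_mul_left,
      hP.tsum_sum_pathSum_wedge_step s hl hl']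
  · rw [norm_indicator_eq_indicator_norm]
    exact Set.indicator_le_indicator (norm_entry_le_norm_apply _ x x)

theorem hasDirPVTrace :
    HasDirPVTrace 0 (kubo P (mulOp fun x => l (x.1 0) * s x.2) (mulOp fun x => l' (x.1 1)))
      (cellConductivity P s) :=
  ⟨_, hP.hasTrace_stripe s hl hl',
    ((hP.hasSum_cellTrace_wedge_fst s hl (.coord 1) 0).mul_left Complex.I).comp
      Finset.tendsto_Icc_neg⟩

end Steps

end IsLocalProj

/-! ### The spin conductivity -/

/-- The diagonal of `s_z / 2`. -/
def spin (i : Internal N) : ℝ := if i.2 = 0 then 1 / 2 else -(1 / 2)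

theorem prod_latOp_Sz (f : Lattice → ℝ) :
    prod (latOp N f) (Sz N) = mulOp fun x => f x.1 * spin x.2 :=
  prod_mulOp_mulOp _ (C := 1 / 2) fun x => by split_ifs <;> norm_num

theorem conductanceOp_eq_kubo (P : Hdisc N →L[ℂ] Hdisc N) (f g : Lattice → ℝ) :
    conductanceOp P f g = kubo P (mulOp fun x => f x.1 * spin x.2) (mulOp fun x => g x.1) := by
  rw [conductanceOp, prod_latOp_Sz, latOp]

theorem conductivityOp_eq_kubo (P : Hdisc N →L[ℂ] Hdisc N) :
    conductivityOp P =
      kubo P (mulOp fun x => (x.1 0 : ℝ) * spin x.2) (mulOp fun x => (x.1 1 : ℝ)) := by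
  rw [conductivityOp, X, prod_latOp_Sz, X, latOp]

theorem torqueOp_eq_kubo (P : Hdisc N →L[ℂ] Hdisc N) :
    torqueOp P = kubo P (mulOp fun x => spin x.2) (mulOp fun x => (x.1 1 : ℝ)) := rfl

namespace IsLocalProj

variable {P : Hdisc N →L[ℂ] Hdisc N} (hP : IsLocalProj P)

include hP

theorem kernel_conductivityOp (m n p : Lattice) :
    kernel (conductivityOp P) m n =
      kernel (conductivityOp P) (m - p) (n - p) +
        (p 0 : ℂ) • kernel (torqueOp P) (m - p) (n - p) := by
  have hcoord (j : Fin 2) := HasPolyGrowth.coord (N := N) j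
  have htranslate (m : Lattice) (i : Internal N) : (m, i) = translate p (m - p, i) := by
    ext <;> simp
  ext i k
  rw [Matrix.add_apply, Matrix.smul_apply, conductivityOp_eq_kubo, torqueOp_eq_kubo,
    hP.kernel_kubo ((hcoord 0).mul (.internal spin)) (hcoord 1),
    hP.kernel_kubo ((hcoord 0).mul (.internal spin)) (hcoord 1),
    hP.kernel_kubo (.internal spin) (hcoord 1), htranslate m, htranslate n,
    hP.pathSum_wedge_coord_translate spin, smul_eq_mul, mul_add, mul_left_comm]

theorem hasDirPVTrace_conductanceOp {Λ₁ Λ₂ : Lattice → ℝ} (h₁ : IsSwitch 0 Λ₁)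
    (h₂ : IsSwitch 1 Λ₂) :
    HasDirPVTrace 0 (conductanceOp P Λ₁ Λ₂) (cellConductivity P spin) := by
  obtain ⟨l, hl, hΛ₁⟩ := h₁.exists_isStep
  obtain ⟨l', hl', hΛ₂⟩ := h₂.exists_isStep
  simp only [conductanceOp_eq_kubo, hΛ₁, hΛ₂]
  exact hP.hasDirPVTrace spin hl hl'

end IsLocalProj

end SpinTransport

end

theorem theorem2p7_general (N : ℕ) (P : SpinTransport.Hdisc N →L[ℂ] SpinTransport.Hdisc N)
    (hP : SpinTransport.IsLocalProj P) :
    (∀ Λ₂, SpinTransport.IsSwitch 1 Λ₂ → ∀ Λ₁, SpinTransport.IsSwitch 0 Λ₁ → ∀ g : ℂ,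
      SpinTransport.HasDirPVTrace 0 (SpinTransport.conductanceOp P Λ₁ Λ₂) g →
      ∀ Λ₁', SpinTransport.IsSwitch 0 Λ₁' →
        SpinTransport.HasDirPVTrace 0 (SpinTransport.conductanceOp P Λ₁' Λ₂) g) ∧
    (∀ x : SpinTransport.Site N,
      SpinTransport.delta x ∈ (SpinTransport.conductivityOp P).domain ∧
      SpinTransport.delta x ∈ (SpinTransport.torqueOp P).domain) ∧
    (∀ m n p : SpinTransport.Lattice,
      SpinTransport.kernel (SpinTransport.conductivityOp P) m n =
        SpinTransport.kernel (SpinTransport.conductivityOp P) (m - p) (n - p) +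
          (p 0 : ℂ) • SpinTransport.kernel (SpinTransport.torqueOp P) (m - p) (n - p)) ∧
    ∃ σ : ℂ, SpinTransport.HasTUV (SpinTransport.conductivityOp P) σ ∧
      SpinTransport.HasTrace (SpinTransport.prod (SpinTransport.chi N 1)
        (SpinTransport.prod (SpinTransport.conductivityOp P) (SpinTransport.chi N 1))) σ ∧
      ∀ Λ₁ Λ₂, SpinTransport.IsSwitch 0 Λ₁ → SpinTransport.IsSwitch 1 Λ₂ →
        SpinTransport.HasDirPVTrace 0 (SpinTransport.conductanceOp P Λ₁ Λ₂) σ := by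
  have hG := fun Λ₁ Λ₂ h₁ h₂ => hP.hasDirPVTrace_conductanceOp (Λ₁ := Λ₁) (Λ₂ := Λ₂) h₁ h₂
  refine ⟨fun Λ₂ h₂ Λ₁ h₁ g hg Λ₁' h₁' => ?_, fun x => ⟨?_, ?_⟩, hP.kernel_conductivityOp,
    SpinTransport.cellConductivity P SpinTransport.spin, ?_, ?_, hG⟩
  · rw [hg.unique (hG Λ₁ Λ₂ h₁ h₂)]
    exact hG Λ₁' Λ₂ h₁' h₂
  · rw [SpinTransport.conductivityOp_eq_kubo]
    exact hP.mem_domain_kubo ((SpinTransport.HasPolyGrowth.coord 0).mul (.internal _)) (.coord 1) x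
  · rw [SpinTransport.torqueOp_eq_kubo]
    exact hP.mem_domain_kubo (.internal _) (.coord 1) x
  · rw [SpinTransport.conductivityOp_eq_kubo]
    exact hP.hasTUV SpinTransport.spin
  · simpa [SpinTransport.conductivityOp_eq_kubo] using hP.hasTrace_box SpinTransport.spin 0

theorem theorem2p7 (N : ℕ) (H : SpinTransport.Hdisc N →L[ℂ] SpinTransport.Hdisc N)
    (hsa : IsSelfAdjoint H) (hns : SpinTransport.IsNearSighted H)
    (hper : SpinTransport.IsPeriodic H) (a b μ : ℝ) (hgap : SpinTransport.HasSpectralGap H a b)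
    (hμ : μ ∈ Set.Ioo a b) (P : SpinTransport.Hdisc N →L[ℂ] SpinTransport.Hdisc N)
    (hP : P = SpinTransport.fermi H μ) :
    -- (1) if the conductance is finite for one `Λ₁`, it is finite and the same for every `Λ₁'`
    (∀ Λ₂, SpinTransport.IsSwitch 1 Λ₂ → ∀ Λ₁, SpinTransport.IsSwitch 0 Λ₁ → ∀ g : ℂ,
      SpinTransport.HasDirPVTrace 0 (SpinTransport.conductanceOp P Λ₁ Λ₂) g →
      ∀ Λ₁', SpinTransport.IsSwitch 0 Λ₁' →
        SpinTransport.HasDirPVTrace 0 (SpinTransport.conductanceOp P Λ₁' Λ₂) g) ∧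
    -- (2) the kernels of `Σ` and `𝒯` are well defined and satisfy the twisted periodicity relation
    (∀ x : SpinTransport.Site N,
      SpinTransport.delta x ∈ (SpinTransport.conductivityOp P).domain ∧
      SpinTransport.delta x ∈ (SpinTransport.torqueOp P).domain) ∧
    (∀ m n p : SpinTransport.Lattice,
      SpinTransport.kernel (SpinTransport.conductivityOp P) m n =
        SpinTransport.kernel (SpinTransport.conductivityOp P) (m - p) (n - p) +
          (p 0 : ℂ) • SpinTransport.kernel (SpinTransport.torqueOp P) (m - p) (n - p)) ∧
    -- `σ` is the trace per unit volume of `Σ`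
    ∃ σ : ℂ, SpinTransport.HasTUV (SpinTransport.conductivityOp P) σ ∧
      SpinTransport.HasTrace (SpinTransport.prod (SpinTransport.chi N 1)
        (SpinTransport.prod (SpinTransport.conductivityOp P) (SpinTransport.chi N 1))) σ ∧
      -- (3) the conductance is finite and equal to `σ` for all switch functions
      ∀ Λ₁ Λ₂, SpinTransport.IsSwitch 0 Λ₁ → SpinTransport.IsSwitch 1 Λ₂ →
        SpinTransport.HasDirPVTrace 0 (SpinTransport.conductanceOp P Λ₁ Λ₂) σ := by
  exact theorem2p7_general N P
    (hP ▸ SpinTransport.isLocalProj_fermi hsa hns hper (hgap.notMem_spectrum hμ))
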